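/- Let $R$ be a commutative noetherian ring with only finitely many maximal ideals, let $M$ be a nonzero finitely generated $R$-module, and let $S=\mathrm{End}_R(M)$, with Jacobson radical $J(S)$. Let $V^*(M)$ be the commutative monoid of isomorphism classes $[X]$ of countably generated $R$-modules $X$ that are isomorphic to direct summands of direct sums of (arbitrarily many) copies of $M$, with addition $[X]+[Y]=[X\oplus Y]$. Let $\mathbb N_0^*=\mathbb N_0\cup\{\infty\}$, with its usual addition. Then $S$ has, up to isomorphism, only finitely many simple right modules. Let $V_1,\dots,V_s$ be a complete list of pairwise non-isomorphic representatives of them, and let $D_i=\mathrm{End}_S(V_i)$, a division ring. For a right $S$-module $P$ set $$\mathbf{dim}_S(P)=\big(\dim_{D_i}\mathrm{Hom}_S(V_i,P/PJ(S))\big)_{i=1}^s\in(\mathbb N_0^*)^s,$$ where every infinite dimension is written $\infty$, and set $\mathbf D_M([X])=\mathbf{dim}_S(\mathrm{Hom}_R(M,X))$. Then $$\mathbf D_M\colon V^*(M)\to(\mathbb N_0^*)^s$$ is a well-defined injective morphism of monoids, and it is a divisor homomorphism: if $[X],[Y]\in V^*(M)$ and $\mathbf D_M([Y])=\mathbf D_M([X])+c$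 for some $c\in(\mathbb N_0^*)^s$, then $[Y]=[X]+[Z]$ for some $[Z]\in V^*(M)$. -/

import Mathlib

universe u v w

namespace DirectSummands

section Precomp

variable (R : Type u) [Ring R] (M : Type v) [AddCommGroup M] [Module R M]

/-- The opposite ring of `S = End_R(M)`. Left modules over it are the right `S`-modules. -/
abbrev EndOp : Type v := (Module.End R M)ᵐᵒᵖ

variable {R M} {X : Type w} [AddCommGroup X] [Module R X]

/-- `Hom_R(M, X)` is a right module over `End_R(M)` by composition: `f · a = f ∘ a`. -/
instance precompModule : Module (EndOp R M) (M →ₗ[R] X) where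
  smul a f := f.comp a.unop
  one_smul _ := rfl
  mul_smul _ _ _ := rfl
  smul_zero _ := LinearMap.zero_comp _
  smul_add _ _ _ := LinearMap.add_comp _ _ _
  add_smul _ _ _ := LinearMap.comp_add _ _ _
  zero_smul _ := LinearMap.comp_zero _

/-- An isomorphism `X ≃ Y` induces an isomorphism `Hom_R(M, X) ≃ Hom_R(M, Y)` of right
`End_R(M)`-modules. -/
def homCongr {Y : Type w} [AddCommGroup Y] [Module R Y] (e : X ≃ₗ[R] Y) :
    (M →ₗ[R] X) ≃ₗ[EndOp R M] (M →ₗ[R] Y) where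
  toFun f := (e : X →ₗ[R] Y).comp f
  invFun g := (e.symm : Y →ₗ[R] X).comp g
  map_add' _ _ := LinearMap.comp_add _ _ _
  map_smul' _ _ := rfl
  left_inv f := by ext; simp
  right_inv g := by ext; simp

end Precomp

section VStar

variable (R : Type u) [Ring R] (M : Type v) [AddCommGroup M] [Module R M]

/-- `X` is a countably generated `R`-module. -/
def IsCountablyGenerated (X : Type v) [AddCommGroup X] [Module R X] : Prop :=
  ∃ A : Set X, A.Countable ∧ Submodule.span R A = ⊤

/-- `X` belongs to `Add(M)`: it is isomorphic to a direct summand of a direct sum `M^(I)` of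
an arbitrary number of copies of `M`. -/
def InAdd (X : Type v) [AddCommGroup X] [Module R X] : Prop :=
  ∃ (I : Type v) (Y : ModuleCat.{v} R), Nonempty ((X × Y) ≃ₗ[R] (I →₀ M))

/-- The countably generated modules in `Add(M)`. -/
def AddCtbl : Type (max u (v + 1)) :=
  {X : ModuleCat.{v} R // IsCountablyGenerated R X ∧ InAdd R M X}

/-- Isomorphism of countably generated modules in `Add(M)`. -/
def isoSetoid : Setoid (AddCtbl R M) where
  r X Y := Nonempty (X.1 ≃ₗ[R] Y.1)
  iseqv :=
    { refl := fun _ => ⟨LinearEquiv.refl _ _⟩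
      symm := fun ⟨e⟩ => ⟨e.symm⟩
      trans := fun ⟨e⟩ ⟨f⟩ => ⟨e.trans f⟩ }

/-- `V*(M)`: the isomorphism classes of countably generated modules in `Add(M)`. -/
def VStar : Type (max u (v + 1)) := Quotient (isoSetoid R M)

variable {R M}

theorem IsCountablyGenerated.prod {X Y : Type v} [AddCommGroup X] [Module R X] [AddCommGroup Y]
    [Module R Y] (hX : IsCountablyGenerated R X) (hY : IsCountablyGenerated R Y) :
    IsCountablyGenerated R (X × Y) := by
  obtain ⟨A, hA, hA'⟩ := hX
  obtain ⟨B, hB, hB'⟩ := hY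
  refine ⟨LinearMap.inl R X Y '' A ∪ LinearMap.inr R X Y '' B,
    (hA.image _).union (hB.image _), ?_⟩
  rw [LinearMap.span_inl_union_inr, hA', hB', Submodule.prod_top]

theorem InAdd.prod {X Y : Type v} [AddCommGroup X] [Module R X] [AddCommGroup Y]
    [Module R Y] (hX : InAdd R M X) (hY : InAdd R M Y) : InAdd R M (X × Y) := by
  obtain ⟨I, X', ⟨e⟩⟩ := hX
  obtain ⟨J, Y', ⟨f⟩⟩ := hY
  refine ⟨I ⊕ J, ModuleCat.of R (X' × Y'), ⟨?_⟩⟩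
  exact (LinearEquiv.prodProdProdComm R X Y X' Y').trans
    ((LinearEquiv.prodCongr e f).trans (Finsupp.sumFinsuppLEquivProdFinsupp R).symm)

/-- The direct sum `X ⊕ Y` of countably generated modules in `Add(M)`. -/
def AddCtbl.sum (X Y : AddCtbl R M) : AddCtbl R M :=
  ⟨ModuleCat.of R (X.1 × Y.1), X.2.1.prod Y.2.1, X.2.2.prod Y.2.2⟩

/-- The zero module, as a member of `Add(M)`. -/
def AddCtbl.zero : AddCtbl R M :=
  ⟨ModuleCat.of R PUnit.{v + 1}, ⟨∅, Set.countable_empty, Subsingleton.elim _ _⟩,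
    PEmpty.{v + 1}, ModuleCat.of R PUnit.{v + 1}, ⟨0, 0, fun _ => rfl, fun _ => Subsingleton.elim _ _⟩⟩

/-- The class `[X]` in `V*(M)`. -/
def VStar.mk (X : AddCtbl R M) : VStar R M := Quotient.mk (isoSetoid R M) X

theorem VStar.sound {X Y : AddCtbl R M} (e : X.1 ≃ₗ[R] Y.1) : VStar.mk X = VStar.mk Y :=
  Quotient.sound (s := isoSetoid R M) ⟨e⟩

/-- Addition on `V*(M)`: `[X] + [Y] = [X ⊕ Y]`. -/
instance : Add (VStar R M) where
  add := Quotient.map₂ (sa := isoSetoid R M) (sb := isoSetoid R M) (sc := isoSetoid R M)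
    AddCtbl.sum (fun _ _ ⟨e⟩ _ _ ⟨f⟩ => ⟨LinearEquiv.prodCongr e f⟩)

instance : Zero (VStar R M) where
  zero := VStar.mk AddCtbl.zero

instance : AddCommMonoid (VStar R M) where
  add_assoc := by
    rintro ⟨X⟩ ⟨Y⟩ ⟨Z⟩
    exact VStar.sound (LinearEquiv.prodAssoc R X.1 Y.1 Z.1)
  zero_add := by
    rintro ⟨X⟩
    exact VStar.sound (LinearEquiv.uniqueProd (R := R) (M := X.1) (M₂ := PUnit.{v + 1}))
  add_zero := by
    rintro ⟨X⟩
    exact VStar.sound (LinearEquiv.prodUnique (R := R) (M := X.1) (M₂ := PUnit.{v + 1}))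
  add_comm := by
    rintro ⟨X⟩ ⟨Y⟩
    exact VStar.sound (LinearEquiv.prodComm R X.1 Y.1)
  nsmul := nsmulRec

end VStar

section Dim

variable {T : Type w} [Ring T] {s : ℕ}

/-- `V 1, …, V s` is a complete, irredundant list of the simple `T`-modules up to isomorphism. -/
structure IsSimpleSystem (V : Fin s → ModuleCat.{w} T) : Prop where
  simple : ∀ i, IsSimpleModule T (V i)
  irredundant : ∀ i j, Nonempty (V i ≃ₗ[T] V j) → i = j
  complete : ∀ W : ModuleCat.{w} T, IsSimpleModule T W → ∃ i, Nonempty (W ≃ₗ[T] V i)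

/-- The dimension vector of a `T`-module `P`: its `i`-th entry is the dimension of
`Hom_T(V i, P / J(T) P)` over the division ring `End_T(V i)`, which acts on the right by
composition; all infinite dimensions are identified with `∞`. -/
noncomputable def dimVec (V : Fin s → ModuleCat.{w} T) (P : Type v) [AddCommGroup P]
    [Module T P] : Fin s → ℕ∞ := fun i =>
  Cardinal.toENat (Module.rank (EndOp T (V i))
    (V i →ₗ[T] P ⧸ (Ring.jacobson T • ⊤ : Submodule T P)))

theorem dimVec_congr (V : Fin s → ModuleCat.{w} T) {P Q : Type v} [AddCommGroup P]
    [Module T P] [AddCommGroup Q] [Module T Q] (e : P ≃ₗ[T] Q) : dimVec V P = dimVec V Q := by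
  funext i
  have h : Submodule.map (e : P →ₗ[T] Q) (Ring.jacobson T • ⊤) = Ring.jacobson T • ⊤ := by
    rw [Submodule.map_smul'', Submodule.map_top, LinearEquiv.range]
  exact congrArg Cardinal.toENat
    (homCongr (M := V i) (Submodule.Quotient.equiv _ _ e h)).rank_eq

end Dim

section DMap

variable {R : Type u} [Ring R] {M : Type v} [AddCommGroup M] [Module R M]

/-- The map `D_M : V*(M) → (ℕ ∪ {∞})^s` sending `[X]` to the dimension vector of the right
`S`-module `Hom_R(M, X)`, where `S = End_R(M)`. -/
noncomputable def DMap {s : ℕ} (V : Fin s → ModuleCat.{v} (EndOp R M)) :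
    VStar R M → (Fin s → ℕ∞) :=
  Quotient.lift (s := isoSetoid R M) (fun X => dimVec V (M →ₗ[R] X.1))
    (fun _ _ ⟨e⟩ => dimVec_congr V (homCongr e))

end DMap

/-- A morphism `f` of commutative monoids is a divisor homomorphism if `f a ∣ f b` implies
`a ∣ b`, where (additively) `a ∣ b` means that `b = a + c` for some `c`. -/
def IsDivisorHom {A : Type u} {B : Type v} [AddCommMonoid A] [AddCommMonoid B] (f : A →+ B) :
    Prop :=
  ∀ a b : A, (∃ c : B, f b = f a + c) → ∃ c : A, b = a + c

end DirectSummands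

/-! Write `T = EndOp R M` and `J = J(T)`. As `M` is finitely generated, `Hom_R(M, -)` is fully
faithful on `Add(M)` and carries its countably generated objects to countably generated projective
`T`-modules. As `T` is module-finite over a semilocal noetherian commutative ring, it is noetherian
and `T/J` is semisimple. Everything then reduces to countably generated projectives `P`, `Q` over
`T`.

Injectivity: for such modules the dimension vector determines `P/JP`, and `P/JP` determines `P`. The
latter (`nonempty_linearEquiv_of_congrMod`) is a back-and-forth argument: a lift of an isomorphism
modulo `J` can be inverted on any finite set, without changing its class modulo `J`.

Divisor property: suppose `dim P ≤ dim Q`. There are `f : P → Q` and `g : Q → P` with `gf = 1`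
modulo `J`, but `f` need not split. Choose a finite `X ⊆ Q` such that maps from `Q` to simples of
finite multiplicity are determined on `X`, and let `I` be the ideal generated by the values of maps
`Q → T` vanishing on `X`. Then `Q/IQ` is finitely generated, so Nakayama's lemma corrects `g` to
`g'` with `g'f = 1` modulo `I`. Moreover `I` is idempotent, so there is a countably generated
projective `L` with `IL = L` through whose countable powers the error `1 - g'f` factors
(`exists_projective_of_idempotent`, `exists_factorization`). Hence `P` is a summand of `Q ⊕ L^(C)`
with `C` countable. As `I` kills the simples of finite multiplicity in `Q`, adding `L^(C)` does not
change the dimension vector, so `Q ⊕ L^(C) ≅ Q` by the first half. -/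

namespace DirectSummands

/-! ### Module-finite algebras over semilocal commutative rings -/

section Semilocal

/-- If `A / J(A)` is semisimple, every `A`-module killed by `J(A)` is semisimple. -/
theorem isSemisimpleModule_of_jacobson_smul_eq_zero (A : Type*) [Ring A]
    [IsSemisimpleModule A (A ⧸ Ring.jacobson A)] (N : Type*) [AddCommGroup N] [Module A N]
    (h : ∀ r ∈ Ring.jacobson A, ∀ x : N, r • x = 0) : IsSemisimpleModule A N := by
  have hk : ∀ x : N, Ring.jacobson A ≤ LinearMap.ker (LinearMap.toSpanSingleton A N x) := by
    intro x r hr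
    simpa using h r hr x
  refine isSemisimpleModule_of_isSemisimpleModule_submodule'
    (p := fun x : N => LinearMap.range ((Ring.jacobson A).liftQ _ (hk x)))
    (fun x => IsSemisimpleModule.range _) ?_
  rw [eq_top_iff]
  intro x _
  refine Submodule.mem_iSup_of_mem x ⟨Submodule.Quotient.mk 1, ?_⟩
  exact (Submodule.liftQ_apply _ _ _).trans (one_smul A x)

/-- The quotient of a module by `J(A)` times it is semisimple when `A / J(A)` is. -/
theorem isSemisimpleModule_quotient_jacobson_smul (A : Type*) [Ring A]
    [IsSemisimpleModule A (A ⧸ Ring.jacobson A)] (N : Type*) [AddCommGroup N] [Module A N] :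
    IsSemisimpleModule A (N ⧸ (Ring.jacobson A • ⊤ : Submodule A N)) := by
  refine isSemisimpleModule_of_jacobson_smul_eq_zero A _ fun r hr x => ?_
  obtain ⟨x, rfl⟩ := Submodule.Quotient.mk_surjective _ x
  rw [← Submodule.Quotient.mk_smul, Submodule.Quotient.mk_eq_zero]
  exact Submodule.smul_mem_smul hr trivial

variable (R : Type*) [CommRing R]

/-- `R / J(R)` embeds in the finite product of the residue fields. -/
theorem isSemisimpleModule_quotient_jacobson_of_finite [Finite (MaximalSpectrum R)] :
    IsSemisimpleModule R (R ⧸ Ring.jacobson R) := by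
  have hs : ∀ m : MaximalSpectrum R, IsSimpleModule R (R ⧸ m.asIdeal) := fun m =>
    isSimpleModule_iff_isCoatom.mpr m.isMaximal.out
  let f : R →ₗ[R] (∀ m : MaximalSpectrum R, R ⧸ m.asIdeal) :=
    LinearMap.pi fun m => m.asIdeal.mkQ
  have hf : LinearMap.ker f = Ring.jacobson R := by
    ext r
    rw [LinearMap.mem_ker, Ring.jacobson_eq_sInf_isMaximal, Submodule.mem_sInf]
    constructor
    · intro h I hI
      have := congrFun h ⟨I, hI⟩
      simpa [f, Ideal.Quotient.eq_zero_iff_mem] using this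
    · intro h
      funext m
      simpa [f, Ideal.Quotient.eq_zero_iff_mem] using h m.asIdeal m.isMaximal
  refine IsSemisimpleModule.of_injective ((Ring.jacobson R).liftQ f hf.ge) ?_
  rw [← LinearMap.ker_eq_bot, Submodule.ker_liftQ_eq_bot _ _ _ hf.le]

variable (T : Type*) [Ring T] [Algebra R T] [Module.Finite R T]

/-- On a simple quotient `T ⧸ I`, multiplication by the central element `r` has image zero or
everything; the second is excluded by Nakayama's lemma over `R`, as `T ⧸ I` is finite over `R`. -/
theorem algebraMap_mem_jacobson {r : R} (hr : r ∈ Ring.jacobson R) :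
    algebraMap R T r ∈ Ring.jacobson T := by
  rw [Ring.jacobson_eq_sInf_isMaximal, Submodule.mem_sInf]
  intro I hI
  have hs : IsSimpleModule T (T ⧸ I) := isSimpleModule_iff_isCoatom.mpr (Ideal.isMaximal_def.mp hI)
  let N : Submodule T (T ⧸ I) :=
    LinearMap.range ({ (LinearMap.lsmul R (T ⧸ I) r) with
      map_smul' := fun t x => smul_comm r t x } : (T ⧸ I) →ₗ[T] (T ⧸ I))
  have hN : ∀ x : T ⧸ I, r • x ∈ N := fun x => ⟨x, rfl⟩
  rcases eq_bot_or_eq_top N with h | h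
  · have := hN (Submodule.Quotient.mk 1)
    rw [h, Submodule.mem_bot, ← Submodule.Quotient.mk_smul, Submodule.Quotient.mk_eq_zero] at this
    rwa [Algebra.algebraMap_eq_smul_one]
  · exfalso
    have : (⊤ : Submodule R (T ⧸ I)) = ⊥ := by
      refine Submodule.FG.eq_bot_of_le_jacobson_smul Module.Finite.fg_top ?_
      intro x _
      obtain ⟨y, rfl⟩ : x ∈ N := h ▸ trivial
      exact Submodule.smul_mem_smul hr trivial
    have hn := IsSimpleModule.nontrivial T (T ⧸ I)
    obtain ⟨x, hx⟩ := exists_ne (0 : T ⧸ I)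
    exact hx (by simpa using (this ▸ trivial : x ∈ (⊥ : Submodule R (T ⧸ I))))

/-- A module-finite algebra over a commutative semilocal ring is semilocal. -/
theorem isSemisimpleModule_quotient_jacobson [Finite (MaximalSpectrum R)] :
    IsSemisimpleModule T (T ⧸ Ring.jacobson T) := by
  have := isSemisimpleModule_quotient_jacobson_of_finite R
  have : IsSemisimpleModule R (T ⧸ Ring.jacobson T) := by
    refine isSemisimpleModule_of_jacobson_smul_eq_zero R _ fun r hr x => ?_
    obtain ⟨x, rfl⟩ := Submodule.Quotient.mk_surjective _ x
    rw [← Submodule.Quotient.mk_smul, Submodule.Quotient.mk_eq_zero, Algebra.smul_def]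
    exact Ideal.mul_mem_right _ _ (algebraMap_mem_jacobson R T hr)
  have : IsArtinian T (T ⧸ Ring.jacobson T) := isArtinian_of_tower R inferInstance
  exact (IsArtinian.isSemisimpleModule_iff_jacobson _ _).mpr (Module.jacobson_quotient_jacobson T T)

end Semilocal

/-! ### Finiteness of the set of simple modules -/

section SimpleSystem

/-- A semilocal ring has only finitely many simple modules up to isomorphism. -/
theorem exists_isSimpleSystem (T : Type w) [Ring T] [IsSemisimpleModule T (T ⧸ Ring.jacobson T)] :
    ∃ (s : ℕ) (V : Fin s → ModuleCat.{w} T), IsSimpleSystem V := by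
  let N := T ⧸ Ring.jacobson T
  have : IsNoetherian T N := inferInstance
  obtain ⟨s, ⟨e⟩⟩ := Finite.exists_equiv_fin (isotypicComponents T N)
  choose S hS hcS using fun c : isotypicComponents T N => c.2
  refine ⟨s, fun i => ModuleCat.of T (S (e.symm i)), fun i => hS _, ?_, ?_⟩
  · rintro i j ⟨f⟩
    have f' : S (e.symm i) ≃ₗ[T] S (e.symm j) := f
    apply e.symm.injective
    apply Subtype.ext
    rw [hcS (e.symm i), hcS (e.symm j), f'.isotypicComponent_eq]
  · intro W hW
    -- A simple module is a quotient of `T / J(T)`, hence by semisimplicity also a submodule of it,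
    -- and so lies in an isotypic component.
    obtain ⟨m, hm, ⟨f⟩⟩ := isSimpleModule_iff_quot_maximal.mp hW
    let g : N →ₗ[T] W := f.symm.toLinearMap ∘ₗ Submodule.factor (Ring.jacobson_le_of_isMaximal m)
    have hg : Function.Surjective g := f.symm.surjective.comp (Submodule.factor_surjective _)
    obtain ⟨K, ⟨k⟩⟩ := IsSemisimpleModule.exists_submodule_linearEquiv_quotient (LinearMap.ker g)
    have k' : K ≃ₗ[T] W := k.trans (g.quotKerEquivOfSurjective hg)
    have hK : IsSimpleModule T K := IsSimpleModule.congr k'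
    let c : isotypicComponents T N := ⟨isotypicComponent T N K, K, hK, rfl⟩
    have hc : isotypicComponent T N K = isotypicComponent T N (S c) := hcS c
    have := hS c
    have h1 : Nonempty (K ≃ₗ[T] S c) :=
      (isIsotypicOfType_submodule_iff.mp (IsIsotypicOfType.isotypicComponent T N (S c)))
        K (hc ▸ K.le_isotypicComponent)
    obtain ⟨q⟩ := h1
    refine ⟨e c, ?_⟩
    rw [Equiv.symm_apply_apply]
    exact ⟨k'.symm.trans q⟩

end SimpleSystem

/-! ### Projective modules modulo the radical -/

section RadicalFactors

variable {T : Type*} [Ring T] {P Q : Type*} [AddCommGroup P] [Module T P]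
  [AddCommGroup Q] [Module T Q]

theorem map_mem_smul_top (I : Ideal T) (f : P →ₗ[T] Q) {x : P} (hx : x ∈ (I • ⊤ : Submodule T P)) :
    f x ∈ (I • ⊤ : Submodule T Q) := by
  have := Submodule.mem_map_of_mem (f := f) hx
  rw [Submodule.map_smul''] at this
  exact Submodule.smul_mono le_rfl le_top this

theorem map_mem_of_mem_smul_top (I : Ideal T) [I.IsTwoSided] (f : P →ₗ[T] T) {x : P}
    (hx : x ∈ (I • ⊤ : Submodule T P)) : f x ∈ I := by
  have h := map_mem_smul_top I f hx
  refine (Submodule.smul_le.mpr fun r hr t _ => ?_ : (I • ⊤ : Submodule T T) ≤ I) h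
  exact I.mul_mem_right t hr

theorem isUnit_of_sub_one_mem_jacobson {c : T} (hc : c - 1 ∈ Ring.jacobson T) : IsUnit c := by
  rw [← Ideal.jacobson_bot] at hc
  obtain ⟨s, hs⟩ := Ideal.exists_mul_sub_mem_of_sub_one_mem_jacobson c hc
  have hs' : s * c = 1 := sub_eq_zero.mp hs
  have h2 : s - 1 ∈ Ideal.jacobson (⊥ : Ideal T) := by
    have : s - 1 = -(s * (c - 1)) := by rw [mul_sub, hs']; simp
    rw [this]
    exact neg_mem (Ideal.mul_mem_left _ _ hc)
  obtain ⟨u, hu⟩ := Ideal.exists_mul_sub_mem_of_sub_one_mem_jacobson s h2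
  have hu' : u * s = 1 := sub_eq_zero.mp hu
  have : u = c := by rw [← mul_one u, ← hs', ← mul_assoc, hu', one_mul]
  exact ⟨⟨c, s, this ▸ hu', hs'⟩, rfl⟩

/-- Two linear maps agree modulo `I`. -/
def CongrMod (I : Ideal T) (f g : P →ₗ[T] Q) : Prop :=
  ∀ x, f x - g x ∈ (I • ⊤ : Submodule T Q)

theorem CongrMod.refl (I : Ideal T) (f : P →ₗ[T] Q) : CongrMod I f f := fun x => by simp

theorem CongrMod.trans {I : Ideal T} {f g h : P →ₗ[T] Q} (h₁ : CongrMod I f g)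
    (h₂ : CongrMod I g h) : CongrMod I f h := fun x => by
  simpa using add_mem (h₁ x) (h₂ x)

theorem CongrMod.symm {I : Ideal T} {f g : P →ₗ[T] Q} (h : CongrMod I f g) :
    CongrMod I g f := fun x => by
  simpa using neg_mem (h x)

theorem CongrMod.comp {I : Ideal T} {N : Type*} [AddCommGroup N] [Module T N]
    {f f' : P →ₗ[T] Q} {g g' : Q →ₗ[T] N} (hg : CongrMod I g g') (hf : CongrMod I f f') :
    CongrMod I (g ∘ₗ f) (g' ∘ₗ f') := fun x => by
  have := add_mem (hg (f x)) (map_mem_smul_top I g' (hf x))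
  simpa using this

/-- An endomorphism of a free module congruent to the identity modulo the radical can be
inverted, modulo the radical trivially, on finitely many basis vectors. -/
theorem exists_leftInverse_on_basis {B : Type*} (h : (B →₀ T) →ₗ[T] (B →₀ T))
    (hh : CongrMod (Ring.jacobson T) h LinearMap.id) (S : Finset B) :
    ∃ v : (B →₀ T) →ₗ[T] (B →₀ T), CongrMod (Ring.jacobson T) v LinearMap.id ∧
      ∀ b ∈ S, v (h (Finsupp.single b 1)) = Finsupp.single b 1 := by
  classical
  induction S using Finset.induction_on with
  | empty => exact ⟨LinearMap.id, CongrMod.refl _ _, by simp⟩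
  | insert b S hb ih =>
    obtain ⟨v, hv, hvS⟩ := ih
    let e : B →₀ T := Finsupp.single b 1
    have hk : CongrMod (Ring.jacobson T) (v ∘ₗ h) LinearMap.id := by
      simpa using hv.comp hh
    -- Since `v ∘ h` is the identity modulo the radical, this diagonal coefficient is a unit.
    let c : T := v (h e) b
    have hc : IsUnit c := by
      apply isUnit_of_sub_one_mem_jacobson
      have := map_mem_of_mem_smul_top _ (Finsupp.lapply b) (hk e)
      simpa [c, e] using this
    obtain ⟨c', hcc'⟩ := hc.exists_right_inv
    -- An elementary operation sending `v (h e)` to `e` and fixing every vector with zero `b`-th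
    -- coordinate, in particular the basis vectors already treated.
    let w : (B →₀ T) →ₗ[T] (B →₀ T) := LinearMap.id -
      (LinearMap.toSpanSingleton T (B →₀ T) (c' • (v (h e) - e))) ∘ₗ Finsupp.lapply b
    have hw : ∀ y, w y = y - y b • c' • (v (h e) - e) := fun y => by simp [w]
    refine ⟨w ∘ₗ v, ?_, ?_⟩
    · have hw1 : CongrMod (Ring.jacobson T) w LinearMap.id := fun y => by
        rw [hw, LinearMap.id_apply, sub_sub_cancel_left]
        exact neg_mem (Submodule.smul_mem _ _ (Submodule.smul_mem _ _ (hk e)))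
      simpa using hw1.comp hv
    · intro a ha
      rw [LinearMap.comp_apply, hw]
      rcases Finset.mem_insert.mp ha with rfl | ha
      · change v (h e) - c • c' • (v (h e) - e) = e
        rw [smul_smul, hcc', one_smul, sub_sub_cancel]
      · rw [hvS a ha, Finsupp.single_eq_of_ne (by rintro rfl; exact hb ha), zero_smul, sub_zero]

/-- An endomorphism of a projective module congruent to the identity modulo the radical can be
inverted on any finite set. -/
theorem exists_leftInverse_on_finset [Module.Projective T P] (h : P →ₗ[T] P)
    (hh : CongrMod (Ring.jacobson T) h LinearMap.id) (X : Finset P) :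
    ∃ v : P →ₗ[T] P, CongrMod (Ring.jacobson T) v LinearMap.id ∧ ∀ x ∈ X, v (h x) = x := by
  classical
  obtain ⟨s, hs⟩ := (Module.projective_def' (R := T) (P := P)).mp inferInstance
  let p : (P →₀ T) →ₗ[T] P := Finsupp.linearCombination T id
  have hps : ∀ x, p (s x) = x := fun x => LinearMap.congr_fun hs x
  -- `h` on the summand `s(P)` of the free module, extended by the identity on the complement `ker
  -- p`.
  let k : (P →₀ T) →ₗ[T] (P →₀ T) := s ∘ₗ h ∘ₗ p + (LinearMap.id - s ∘ₗ p)
  have hk : CongrMod (Ring.jacobson T) k LinearMap.id := fun y => by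
    have := map_mem_smul_top (Ring.jacobson T) s (hh (p y))
    have e : k y - y = s (h (p y) - p y) := by
      simp [k]; abel
    rw [LinearMap.id_apply, e]; exact this
  obtain ⟨v, hv, hvX⟩ := exists_leftInverse_on_basis k hk (X.biUnion fun x => (s x).support)
  refine ⟨p ∘ₗ v ∘ₗ s, fun x => ?_, fun x hx => ?_⟩
  · have := map_mem_smul_top (Ring.jacobson T) p (hv (s x))
    simpa [hps] using this
  · have h1 : k (s x) = s (h x) := by simp [k, hps]
    have h2 : ∀ y : P →₀ T, y.support ⊆ (X.biUnion fun x => (s x).support) → v (k y) = y := by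
      intro y hy
      conv_rhs => rw [← Finsupp.sum_single y]
      conv_lhs => rw [← Finsupp.sum_single y]
      rw [Finsupp.sum, map_sum, map_sum]
      refine Finset.sum_congr rfl fun b hb => ?_
      rw [← mul_one (y b), ← smul_eq_mul, ← Finsupp.smul_single, map_smul, map_smul,
        hvX b (hy hb)]
    change p (v (s (h x))) = x
    rw [← h1, h2 _ (Finset.subset_biUnion_of_mem (fun x => (s x).support) hx), hps]

theorem exists_retraction_on_finset [Module.Projective T P] (f : P →ₗ[T] Q) (g : Q →ₗ[T] P)
    (h : CongrMod (Ring.jacobson T) (g ∘ₗ f) LinearMap.id) (X : Finset P) :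
    ∃ g' : Q →ₗ[T] P, CongrMod (Ring.jacobson T) g' g ∧ ∀ x ∈ X, g' (f x) = x := by
  obtain ⟨v, hv, hvX⟩ := exists_leftInverse_on_finset _ h X
  exact ⟨v ∘ₗ g, by simpa using hv.comp (CongrMod.refl _ g), hvX⟩

/-- A lift of a split monomorphism modulo the radical is injective. -/
theorem injective_of_congrMod [Module.Projective T P] (f : P →ₗ[T] Q) (g : Q →ₗ[T] P)
    (h : CongrMod (Ring.jacobson T) (g ∘ₗ f) LinearMap.id) : Function.Injective f := by
  rw [injective_iff_map_eq_zero]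
  intro x hx
  obtain ⟨g', -, hg'⟩ := exists_retraction_on_finset f g h {x}
  rw [← hg' x (by simp), hx, map_zero]

/-- The pointwise limit of a sequence of linear maps that is pointwise eventually constant. -/
theorem exists_limit (f : ℕ → P →ₗ[T] Q) (h : ∀ x, ∃ N, ∀ n ≥ N, f n x = f N x) :
    ∃ F : P →ₗ[T] Q, ∀ x, ∃ N, ∀ n ≥ N, f n x = F x := by
  choose N hN using h
  refine ⟨{ toFun := fun x => f (N x) x, map_add' := fun x y => ?_, map_smul' := fun t x => ?_ },
    fun x => ⟨N x, hN x⟩⟩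
  · let n := max (N (x + y)) (max (N x) (N y))
    rw [← hN (x + y) n (le_max_left _ _), ← hN x n (by simp [n]), ← hN y n (by simp [n]), map_add]
  · let n := max (N (t • x)) (N x)
    rw [← hN (t • x) n (le_max_left _ _), ← hN x n (by simp [n]), map_smul, RingHom.id_apply]

/-- Countably generated modules, in terms of a generating sequence. -/
def IsCountablySpanned (T P : Type*) [Ring T] [AddCommGroup P] [Module T P] : Prop :=
  ∃ p : ℕ → P, Submodule.span T (Set.range p) = ⊤

theorem exists_lift_of_quotient [Module.Projective T P] (I : Ideal T)
    (a : (P ⧸ (I • ⊤ : Submodule T P)) →ₗ[T] (Q ⧸ (I • ⊤ : Submodule T Q))) :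
    ∃ f : P →ₗ[T] Q, ∀ x, (Submodule.Quotient.mk (f x) : Q ⧸ (I • ⊤ : Submodule T Q)) =
      a (Submodule.Quotient.mk x) := by
  obtain ⟨f, hf⟩ := Module.projective_lifting_property (Submodule.mkQ (I • ⊤ : Submodule T Q))
    (a ∘ₗ Submodule.mkQ _) (Submodule.mkQ_surjective _)
  exact ⟨f, fun x => LinearMap.congr_fun hf x⟩

/-- Countably generated projective modules are determined by their radical factors. -/
theorem nonempty_linearEquiv_of_congrMod [Module.Projective T P] [Module.Projective T Q]
    (hP : IsCountablySpanned T P) (hQ : IsCountablySpanned T Q)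
    (f : P →ₗ[T] Q) (g : Q →ₗ[T] P)
    (hgf : CongrMod (Ring.jacobson T) (g ∘ₗ f) LinearMap.id)
    (hfg : CongrMod (Ring.jacobson T) (f ∘ₗ g) LinearMap.id) : Nonempty (P ≃ₗ[T] Q) := by
  classical
  obtain ⟨p, hp⟩ := hP
  obtain ⟨q, hq⟩ := hQ
  -- A stage of the back-and-forth: a map congruent to `f`, with a finite set on which it is frozen
  -- from now on.
  let St := {k : P →ₗ[T] Q // CongrMod (Ring.jacobson T) k f} × Finset P
  have step : ∀ (n : ℕ) (a : St), ∃ b : St, (∀ x ∈ a.2, b.1.1 x = a.1.1 x) ∧ a.2 ⊆ b.2 ∧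
      p n ∈ b.2 ∧ ∃ x ∈ b.2, b.1.1 x = q n := by
    rintro n ⟨⟨k, hk⟩, X⟩
    have h1 : CongrMod (Ring.jacobson T) (g ∘ₗ k) LinearMap.id :=
      ((CongrMod.refl _ g).comp hk).trans hgf
    obtain ⟨l, hl, hlX⟩ := exists_retraction_on_finset k g h1 X
    have h2 : CongrMod (Ring.jacobson T) (k ∘ₗ l) LinearMap.id := (hk.comp hl).trans hfg
    -- Inverting `l` in turn on `k(X)` gives `k' x = k' (l (k x)) = k x` for `x ∈ X`, while `q n =
    -- k' (l (q n))` enters the image.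
    obtain ⟨k', hk', hkX⟩ := exists_retraction_on_finset l k h2 (insert (q n) (X.image k))
    refine ⟨⟨⟨k', hk'.trans hk⟩, insert (p n) (insert (l (q n)) X)⟩, ?_, ?_, ?_, ?_⟩
    · intro x hx
      have := hkX (k x) (by simp only [Finset.mem_insert, Finset.mem_image]; exact .inr ⟨x, hx, rfl⟩)
      rwa [hlX x hx] at this
    · intro x hx; simp [hx]
    · simp
    · exact ⟨l (q n), by simp, hkX _ (by simp)⟩
  choose nx hnx1 hnx2 hnx3 hnx4 using step
  let a : ℕ → St := fun n => Nat.rec ⟨⟨f, CongrMod.refl _ _⟩, ∅⟩ (fun n b => nx n b) n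
  have ha : ∀ n, a (n + 1) = nx n (a n) := fun n => rfl
  have hmono : Monotone fun n => (a n).2 := monotone_nat_of_le_succ fun n => by
    rw [ha]; exact hnx2 _ _
  have hst : ∀ n, ∀ m ≥ n, ∀ x ∈ (a n).2, (a m).1.1 x = (a n).1.1 x := by
    intro n m hm x hx
    induction m, hm using Nat.le_induction with
    | base => rfl
    | succ m hm ih => rw [ha, hnx1 _ _ _ (hmono hm hx), ih]
  have hst' : ∀ n, ∀ m ≥ n, ∀ x ∈ Submodule.span T ((a n).2 : Set P),
      (a m).1.1 x = (a n).1.1 x := by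
    intro n m hm x hx
    exact LinearMap.eqOn_span (fun y hy => hst n m hm y hy) hx
  have hspan : ∀ x : P, ∃ n, x ∈ Submodule.span T ((a n).2 : Set P) := by
    have hd : Directed (· ≤ ·) fun n => Submodule.span T ((a n).2 : Set P) :=
      Monotone.directed_le fun n m h => Submodule.span_mono (by exact_mod_cast hmono h)
    intro x
    rw [← Submodule.mem_iSup_of_directed _ hd]
    have : (⊤ : Submodule T P) ≤ ⨆ n, Submodule.span T ((a n).2 : Set P) := by
      rw [← hp, Submodule.span_le]
      rintro _ ⟨n, rfl⟩
      exact Submodule.mem_iSup_of_mem (n + 1) (Submodule.subset_span (by rw [ha]; exact hnx3 _ _))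
    exact this trivial
  obtain ⟨F, hF⟩ := exists_limit (fun n => (a n).1.1) (fun x => by
    obtain ⟨n, hn⟩ := hspan x
    exact ⟨n, fun m hm => hst' n m hm x hn⟩)
  refine ⟨LinearEquiv.ofBijective F ⟨?_, ?_⟩⟩
  · rw [injective_iff_map_eq_zero]
    intro x hx
    obtain ⟨n, hn⟩ := hF x
    -- Each stage is injective, and the limit agrees at `x` with some stage.
    refine (injective_iff_map_eq_zero _).mp (injective_of_congrMod (a n).1.1 g
      (((CongrMod.refl _ g).comp (a n).1.2).trans hgf)) x ?_
    rw [hn n le_rfl, hx]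
  · rw [← LinearMap.range_eq_top, eq_top_iff, ← hq, Submodule.span_le]
    rintro _ ⟨n, rfl⟩
    obtain ⟨x, hx, hxq⟩ := hnx4 n (a n)
    rw [← ha] at hx hxq
    obtain ⟨N, hN⟩ := hF x
    refine ⟨x, ?_⟩
    rw [← hN (max N (n + 1)) (le_max_left _ _), hst _ _ (le_max_right _ _) x hx, hxq]

theorem nonempty_linearEquiv_of_quotient [Module.Projective T P] [Module.Projective T Q]
    (hP : IsCountablySpanned T P) (hQ : IsCountablySpanned T Q)
    (e : (P ⧸ (Ring.jacobson T • ⊤ : Submodule T P)) ≃ₗ[T]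
      (Q ⧸ (Ring.jacobson T • ⊤ : Submodule T Q))) : Nonempty (P ≃ₗ[T] Q) := by
  obtain ⟨f, hf⟩ := exists_lift_of_quotient _ e.toLinearMap
  obtain ⟨g, hg⟩ := exists_lift_of_quotient _ e.symm.toLinearMap
  refine nonempty_linearEquiv_of_congrMod hP hQ f g (fun x => ?_) (fun x => ?_) <;>
    rw [← Submodule.Quotient.mk_eq_zero] <;>
    simp [hf, hg]

end RadicalFactors

/-! ### Maps from a finitely generated module to a direct sum of copies of it -/

section HomFinsupp

variable {R M X Y : Type*} [Ring R] [AddCommGroup M] [Module R M] [AddCommGroup X] [Module R X]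
  [AddCommGroup Y] [Module R Y]

/-- Composition with `g : X → Y`, as a map `Hom_R(M, X) → Hom_R(M, Y)` of right
`End_R(M)`-modules. -/
def postcomp (g : X →ₗ[R] Y) : (M →ₗ[R] X) →ₗ[EndOp R M] (M →ₗ[R] Y) where
  toFun f := g ∘ₗ f
  map_add' _ _ := LinearMap.comp_add _ _ _
  map_smul' _ _ := rfl

theorem endOp_smul_apply (a : EndOp R M) (f : M →ₗ[R] X) (m : M) : (a • f) m = f (a.unop m) := rfl

theorem linearCombination_lsingle_apply {I : Type*} (c : I →₀ EndOp R M) (m : M) (i : I) :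
    Finsupp.linearCombination (EndOp R M) (fun i => (Finsupp.lsingle i : M →ₗ[R] (I →₀ M))) c m i =
      (c i).unop m := by
  classical
  rw [Finsupp.linearCombination_apply, Finsupp.sum, LinearMap.sum_apply, Finsupp.finsetSum_apply]
  simp only [endOp_smul_apply, Finsupp.lsingle_apply, Finsupp.single_apply]
  rw [Finset.sum_ite_eq' c.support i fun j => (c j).unop m]
  split_ifs with h
  · rfl
  · rw [Finsupp.notMem_support_iff.mp h]; rfl

/-- For finitely generated `M`, maps from `M` to a direct sum of copies of `M` form a free
`End_R(M)`-module. -/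
noncomputable def homFinsuppEquiv [Module.Finite R M] (I : Type*) :
    (I →₀ EndOp R M) ≃ₗ[EndOp R M] (M →ₗ[R] (I →₀ M)) :=
  LinearEquiv.ofBijective
    (Finsupp.linearCombination (EndOp R M) fun i => (Finsupp.lsingle i : M →ₗ[R] (I →₀ M))) <| by
    classical
    constructor
    · intro c d h
      ext i
      apply MulOpposite.unop_injective
      ext m
      rw [← linearCombination_lsingle_apply, h, linearCombination_lsingle_apply]
    · intro f
      obtain ⟨S, hS⟩ := (Module.Finite.fg_top : (⊤ : Submodule R M).FG)
      -- The images of finitely many generators involve only finitely many coordinates.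
      let U : Finset I := S.biUnion fun m => (f m).support
      have hU : ∀ i ∉ U, Finsupp.lapply i ∘ₗ f = 0 := by
        intro i hi
        apply LinearMap.ext_on hS
        intro m hm
        by_contra h0
        exact hi (Finset.mem_biUnion.mpr ⟨m, hm, Finsupp.mem_support_iff.mpr h0⟩)
      refine ⟨Finsupp.onFinset U (fun i => MulOpposite.op (Finsupp.lapply i ∘ₗ f)) ?_, ?_⟩
      · intro i hi
        by_contra h
        exact hi (by rw [hU i h]; rfl)
      · ext m i
        rw [linearCombination_lsingle_apply]
        rfl

end HomFinsupp

/-! ### Multiplicities of the simple modules and the dimension vector -/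

section Semisimple

variable {T : Type w} [Ring T] {s : ℕ} {V : Fin s → ModuleCat.{w} T}

theorem IsSimpleSystem.strongRankCondition (hV : IsSimpleSystem V) (i : Fin s) :
    StrongRankCondition (EndOp T (V i)) := by
  classical
  have := hV.simple i
  let _ : DivisionRing (Module.End T (V i)) := Module.End.instDivisionRing
  infer_instance

theorem IsSimpleSystem.free (hV : IsSimpleSystem V) (i : Fin s) (N : Type*) [AddCommGroup N]
    [Module (EndOp T (V i)) N] : Module.Free (EndOp T (V i)) N := by
  classical
  have := hV.simple i
  let _ : DivisionRing (Module.End T (V i)) := Module.End.instDivisionRing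
  infer_instance

theorem IsSimpleSystem.eq_zero (hV : IsSimpleSystem V) {i j : Fin s} (hij : i ≠ j)
    (f : V i →ₗ[T] V j) : f = 0 := by
  have := hV.simple i
  have := hV.simple j
  rcases f.bijective_or_eq_zero with h | h
  · exact absurd (hV.irredundant i j ⟨LinearEquiv.ofBijective f h⟩) hij
  · exact h

/-- A semisimple module decomposes into copies of the modules of a simple system. -/
theorem IsSimpleSystem.exists_linearEquiv (hV : IsSimpleSystem V) (A : Type w) [AddCommGroup A]
    [Module T A] [IsSemisimpleModule T A] :
    ∃ κ : Fin s → Type w, Nonempty (A ≃ₗ[T] ∀ i, (κ i →₀ V i)) := by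
  classical
  obtain ⟨S, e, -, hS⟩ := IsSemisimpleModule.exists_linearEquiv_dfinsupp T A
  choose t ht using fun m : S => hV.complete (ModuleCat.of T m.1) (hS m)
  have ht' : ∀ (i : Fin s) (m : S), t m = i → Nonempty (m.1 ≃ₗ[T] V i) := by
    rintro i m rfl; exact ht m
  let f := fun (i : Fin s) (m : S) (h : t m = i) => (ht' i m h).some
  suffices h : Nonempty ((Π₀ m : S, m.1) ≃ₗ[T] ∀ i, ({m : S // t m = i} →₀ V i)) from
    ⟨_, h.map e.trans⟩
  let F : (Π₀ m : S, m.1) →ₗ[T] ∀ i, ({m : S // t m = i} →₀ V i) :=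
    LinearMap.pi fun i => DFinsupp.lsum ℕ fun m : S =>
      if h : t m = i then (Finsupp.lsingle ⟨m, h⟩) ∘ₗ (f i m h).toLinearMap else 0
  let G : (∀ i, ({m : S // t m = i} →₀ V i)) →ₗ[T] (Π₀ m : S, m.1) :=
    ∑ i, (Finsupp.lsum ℕ fun m : {m : S // t m = i} =>
      DFinsupp.lsingle (R := T) (M := fun m : S => m.1) m.1 ∘ₗ (f i m.1 m.2).symm.toLinearMap) ∘ₗ
        LinearMap.proj i
  have hF : ∀ (m : S) (x : m.1) (i : Fin s), F (DFinsupp.single m x) i =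
      if h : t m = i then Finsupp.single ⟨m, h⟩ (f i m h x) else 0 := by
    intro m x i
    simp only [F, LinearMap.pi_apply, DFinsupp.lsum_single]
    split_ifs <;> rfl
  have hG : ∀ (i : Fin s) (m : {m : S // t m = i}) (v : V i),
      G (Pi.single i (Finsupp.single m v)) = DFinsupp.single m.1 ((f i m.1 m.2).symm v) := by
    intro i m v
    simp only [G, LinearMap.sum_apply, LinearMap.comp_apply, LinearMap.proj_apply]
    rw [Finset.sum_eq_single i]
    · rw [Pi.single_eq_same, Finsupp.lsum_single]; rfl
    · intro j _ hj
      rw [Pi.single_eq_of_ne hj, map_zero]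
    · simp
  refine ⟨LinearEquiv.ofLinearMap F G ?_ ?_⟩
  · refine LinearMap.pi_ext' fun i => Finsupp.lhom_ext' fun m => LinearMap.ext fun v => ?_
    change F (G (Pi.single i (Finsupp.single m v))) = Pi.single i (Finsupp.single m v)
    rw [hG]
    funext j
    rw [hF]
    obtain ⟨m, rfl⟩ := m
    by_cases h : t m = j
    · subst h
      simp
    · rw [dif_neg h, Pi.single_eq_of_ne (Ne.symm h)]
  · refine DFinsupp.lhom_ext' fun m => LinearMap.ext fun x => ?_
    change G (F (DFinsupp.single m x)) = DFinsupp.single m x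
    have : F (DFinsupp.single m x) = Pi.single (t m) (Finsupp.single ⟨m, rfl⟩ (f _ m rfl x)) := by
      funext j
      rw [hF]
      by_cases h : t m = j
      · subst h
        simp
      · rw [dif_neg h, Pi.single_eq_of_ne (Ne.symm h)]
    rw [this, hG, LinearEquiv.symm_apply_apply]

theorem IsSimpleSystem.map_eq_zero (hV : IsSimpleSystem V) (κ : Fin s → Type w) {i k : Fin s}
    (hik : i ≠ k) (f : V i →ₗ[T] (κ k →₀ V k)) : f = 0 := by
  ext v j
  exact LinearMap.congr_fun (hV.eq_zero hik (Finsupp.lapply j ∘ₗ f)) v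

/-- By Schur's lemma only the `i`-th component receives maps from `V i`; since `V i` is finitely
generated, `homFinsuppEquiv` supplies a basis indexed by `κ i`. -/
theorem IsSimpleSystem.rank_hom (hV : IsSimpleSystem V) (κ : Fin s → Type w) (i : Fin s) :
    Module.rank (EndOp T (V i)) (V i →ₗ[T] ∀ k, (κ k →₀ V k)) = Cardinal.mk (κ i) := by
  have := hV.simple i
  have := hV.strongRankCondition i
  let g : (V i →ₗ[T] ∀ k, (κ k →₀ V k)) →ₗ[EndOp T (V i)] (V i →ₗ[T] (κ i →₀ V i)) :=
    postcomp (LinearMap.proj i)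
  have hg : Function.Bijective g := by
    constructor
    · rw [injective_iff_map_eq_zero]
      intro f hf
      ext v k : 2
      by_cases h : i = k
      · subst h
        exact LinearMap.congr_fun hf v
      · exact LinearMap.congr_fun (hV.map_eq_zero κ h (LinearMap.proj k ∘ₗ f)) v
    · intro f
      refine ⟨LinearMap.single T (fun k => (κ k →₀ V k)) i ∘ₗ f, ?_⟩
      ext v : 1
      exact Pi.single_eq_same _ _
  rw [(LinearEquiv.ofBijective g hg).rank_eq, ← (homFinsuppEquiv (κ i)).rank_eq, rank_finsupp_self]
  simp

theorem IsSimpleSystem.dimVec_eq (hV : IsSimpleSystem V) {P : Type w} [AddCommGroup P] [Module T P]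
    (κ : Fin s → Type w)
    (e : (P ⧸ (Ring.jacobson T • ⊤ : Submodule T P)) ≃ₗ[T] ∀ i, (κ i →₀ V i)) (i : Fin s) :
    dimVec V P i = Cardinal.toENat (Cardinal.mk (κ i)) := by
  rw [← hV.rank_hom κ i]
  exact congrArg Cardinal.toENat (homCongr (M := V i) e).rank_eq

theorem IsCountablySpanned.of_surjective {P Q : Type*} [AddCommGroup P] [Module T P]
    [AddCommGroup Q] [Module T Q] (hP : IsCountablySpanned T P) (f : P →ₗ[T] Q)
    (hf : Function.Surjective f) : IsCountablySpanned T Q := by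
  obtain ⟨p, hp⟩ := hP
  refine ⟨f ∘ p, ?_⟩
  rw [Set.range_comp, Submodule.span_image, hp, Submodule.map_top, LinearMap.range_eq_top.mpr hf]

theorem countable_of_isCountablySpanned_finsupp {κ N : Type*} [AddCommGroup N] [Module T N]
    [Nontrivial N] (h : IsCountablySpanned T (κ →₀ N)) : Countable κ := by
  obtain ⟨p, hp⟩ := h
  have hc : (⋃ n, ((p n).support : Set κ)).Countable :=
    Set.countable_iUnion fun n => (p n).support.countable_toSet
  rw [← Set.countable_univ_iff]
  refine hc.mono fun j _ => ?_
  by_contra hj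
  have h0 : (Finsupp.lapply j : (κ →₀ N) →ₗ[T] N) = 0 := by
    apply LinearMap.ext_on hp
    rintro _ ⟨n, rfl⟩
    by_contra h0
    exact hj (Set.mem_iUnion.mpr ⟨n, Finsupp.mem_support_iff.mpr h0⟩)
  obtain ⟨x, hx⟩ := exists_ne (0 : N)
  apply hx
  simpa using LinearMap.congr_fun h0 (Finsupp.single j x)

theorem IsSimpleSystem.countable (hV : IsSimpleSystem V) {P : Type w} [AddCommGroup P] [Module T P]
    (hP : IsCountablySpanned T P) (κ : Fin s → Type w) (g : P →ₗ[T] ∀ i, (κ i →₀ V i))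
    (hg : Function.Surjective g) (i : Fin s) : Countable (κ i) := by
  have := hV.simple i
  have := IsSimpleModule.nontrivial T (V i)
  exact countable_of_isCountablySpanned_finsupp (T := T)
    (hP.of_surjective (LinearMap.proj i ∘ₗ g) ((LinearMap.proj_surjective (R := T) i).comp hg))

/-- `toENat` identifies all infinite cardinals; countability of `κ` makes this harmless. -/
theorem mk_le_mk_of_toENat_le {κ κ' : Type w} [Countable κ]
    (h : Cardinal.toENat (Cardinal.mk κ) ≤ Cardinal.toENat (Cardinal.mk κ')) :
    Cardinal.mk κ ≤ Cardinal.mk κ' :=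
  (Cardinal.toENat_le_iff_of_le_aleph0 (Cardinal.mk_le_aleph0)).mp h

variable [IsSemisimpleModule T (T ⧸ Ring.jacobson T)] {P Q : Type w} [AddCommGroup P] [Module T P]
  [AddCommGroup Q] [Module T Q]

/-- The coordinates of `P / J(T) P` with respect to a simple system. -/
theorem IsSimpleSystem.exists_coordinates (hV : IsSimpleSystem V) (P : Type w) [AddCommGroup P]
    [Module T P] :
    ∃ κ : Fin s → Type w,
      Nonempty ((P ⧸ (Ring.jacobson T • ⊤ : Submodule T P)) ≃ₗ[T] ∀ i, (κ i →₀ V i)) := by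
  have := isSemisimpleModule_quotient_jacobson_smul T P
  exact hV.exists_linearEquiv _

theorem IsSimpleSystem.nonempty_linearEquiv_quotient (hV : IsSimpleSystem V)
    (hP : IsCountablySpanned T P) (hQ : IsCountablySpanned T Q) (h : dimVec V P = dimVec V Q) :
    Nonempty ((P ⧸ (Ring.jacobson T • ⊤ : Submodule T P)) ≃ₗ[T]
      (Q ⧸ (Ring.jacobson T • ⊤ : Submodule T Q))) := by
  obtain ⟨κ, ⟨e⟩⟩ := hV.exists_coordinates P
  obtain ⟨κ', ⟨e'⟩⟩ := hV.exists_coordinates Q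
  have hc := hV.countable hP κ (e.toLinearMap ∘ₗ Submodule.mkQ _)
    (e.surjective.comp (Submodule.mkQ_surjective _))
  have hc' := hV.countable hQ κ' (e'.toLinearMap ∘ₗ Submodule.mkQ _)
    (e'.surjective.comp (Submodule.mkQ_surjective _))
  have hk : ∀ i, Nonempty (κ i ≃ κ' i) := fun i => by
    have := congrFun h i
    rw [hV.dimVec_eq κ e, hV.dimVec_eq κ' e'] at this
    have := hc i
    have := hc' i
    exact Cardinal.eq.mp (le_antisymm (mk_le_mk_of_toENat_le ‹_ = _›.le)
      (mk_le_mk_of_toENat_le ‹_ = _›.ge))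
  exact ⟨(e.trans (LinearEquiv.piCongrRight fun i => Finsupp.domLCongr (hk i).some)).trans e'.symm⟩

theorem IsSimpleSystem.exists_split_quotient (hV : IsSimpleSystem V)
    (hP : IsCountablySpanned T P) (h : dimVec V P ≤ dimVec V Q) :
    ∃ (a : (P ⧸ (Ring.jacobson T • ⊤ : Submodule T P)) →ₗ[T]
        (Q ⧸ (Ring.jacobson T • ⊤ : Submodule T Q)))
      (b : (Q ⧸ (Ring.jacobson T • ⊤ : Submodule T Q)) →ₗ[T]
        (P ⧸ (Ring.jacobson T • ⊤ : Submodule T P))), ∀ x, b (a x) = x := by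
  obtain ⟨κ, ⟨e⟩⟩ := hV.exists_coordinates P
  obtain ⟨κ', ⟨e'⟩⟩ := hV.exists_coordinates Q
  have hc := hV.countable hP κ (e.toLinearMap ∘ₗ Submodule.mkQ _)
    (e.surjective.comp (Submodule.mkQ_surjective _))
  have hk : ∀ i, Nonempty (κ i ↪ κ' i) := fun i => by
    have h' := h i
    rw [hV.dimVec_eq κ e, hV.dimVec_eq κ' e'] at h'
    have := hc i
    exact mk_le_mk_of_toENat_le h'
  let j := fun i => (hk i).some
  let a : (∀ i, (κ i →₀ V i)) →ₗ[T] ∀ i, (κ' i →₀ V i) :=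
    LinearMap.pi fun i => Finsupp.lmapDomain (V i) T (j i) ∘ₗ LinearMap.proj i
  let b : (∀ i, (κ' i →₀ V i)) →ₗ[T] ∀ i, (κ i →₀ V i) :=
    LinearMap.pi fun i => Finsupp.lcomapDomain (j i) (j i).injective ∘ₗ LinearMap.proj i
  have hab : ∀ x, b (a x) = x := fun x => by
    funext i
    exact Finsupp.comapDomain_mapDomain _ (j i).injective _
  refine ⟨e'.symm.toLinearMap ∘ₗ a ∘ₗ e.toLinearMap, e.symm.toLinearMap ∘ₗ b ∘ₗ e'.toLinearMap,
    fun x => ?_⟩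
  simp [hab]

/-- Finitely many elements detect all maps to the simple modules of finite multiplicity. -/
theorem IsSimpleSystem.exists_finset_detecting (hV : IsSimpleSystem V) (Q : Type w)
    [AddCommGroup Q] [Module T Q] :
    ∃ X : Finset Q, ∀ i, dimVec V Q i ≠ ⊤ → ∀ f : Q →ₗ[T] V i, (∀ x ∈ X, f x = 0) → f = 0 := by
  classical
  obtain ⟨κ, ⟨e⟩⟩ := hV.exists_coordinates Q
  have hne : ∀ i, ∃ v : V i, v ≠ 0 := fun i => by
    have := hV.simple i
    have := IsSimpleModule.nontrivial T (V i)
    exact exists_ne _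
  choose v hv using hne
  let p : Q →ₗ[T] ∀ i, (κ i →₀ V i) := e.toLinearMap ∘ₗ Submodule.mkQ _
  have hp : Function.Surjective p := e.surjective.comp (Submodule.mkQ_surjective _)
  -- Lifts of generators of the simple summands; only those of finite multiplicity enter the finite
  -- set.
  choose q hq using fun (i : Fin s) (j : κ i) => hp (Pi.single i (Finsupp.single j (v i)))
  have hfin : {y : Q | ∃ i, dimVec V Q i ≠ ⊤ ∧ ∃ j : κ i, q i j = y}.Finite := by
    have : {y : Q | ∃ i, dimVec V Q i ≠ ⊤ ∧ ∃ j : κ i, q i j = y} =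
        ⋃ i, {y : Q | dimVec V Q i ≠ ⊤ ∧ ∃ j : κ i, q i j = y} := by ext; simp
    rw [this]
    refine Set.finite_iUnion fun i => ?_
    by_cases h : dimVec V Q i = ⊤
    · simp [h]
    · have : Finite (κ i) := by
        rw [hV.dimVec_eq κ e, Cardinal.toENat_eq_top, not_le, Cardinal.lt_aleph0_iff_finite] at h
        exact h
      exact (Set.finite_range (q i)).subset fun y hy => hy.2
  refine ⟨hfin.toFinset, fun i hi f hf => ?_⟩
  have hs := hV.simple i
  -- A map to a simple module factors through `Q / JQ`, where it is determined on the chosen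
  -- generators.
  have hfJ : (Ring.jacobson T • ⊤ : Submodule T Q) ≤ LinearMap.ker f := by
    refine Submodule.smul_le.mpr fun r hr x _ => ?_
    rw [LinearMap.mem_ker, map_smul]
    exact Module.mem_annihilator.mp (IsSemisimpleModule.jacobson_le_annihilator T (V i) hr) _
  let f' : (∀ i, (κ i →₀ V i)) →ₗ[T] V i := (Submodule.liftQ _ f hfJ) ∘ₗ e.symm.toLinearMap
  have hf' : ∀ x, f' (p x) = f x := fun x => by simp [f', p]
  have h0 : f' = 0 := by
    refine LinearMap.pi_ext' fun k => Finsupp.lhom_ext' fun j => ?_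
    by_cases hk : k = i
    · subst hk
      apply LinearMap.ext_on (IsSimpleModule.span_singleton_eq_top T (hv k))
      rintro _ rfl
      change f' (Pi.single k (Finsupp.single j (v k))) = 0
      rw [← hq, hf']
      exact hf _ (by simpa using ⟨k, hi, j, rfl⟩)
    · exact hV.eq_zero hk _
  ext x
  rw [← hf', h0]
  rfl

/-- A simple module of infinite multiplicity admits nonzero maps vanishing on any finite set. -/
theorem IsSimpleSystem.exists_map_of_dimVec_eq_top (hV : IsSimpleSystem V) {i : Fin s}
    (hi : dimVec V Q i = ⊤) (X : Finset Q) :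
    ∃ f : Q →ₗ[T] V i, (∀ x ∈ X, f x = 0) ∧ f ≠ 0 := by
  classical
  obtain ⟨κ, ⟨e⟩⟩ := hV.exists_coordinates Q
  let p : Q →ₗ[T] (κ i →₀ V i) := LinearMap.proj i ∘ₗ e.toLinearMap ∘ₗ Submodule.mkQ _
  have hp : Function.Surjective p :=
    (LinearMap.proj_surjective (R := T) i).comp (e.surjective.comp (Submodule.mkQ_surjective _))
  rw [hV.dimVec_eq κ e, Cardinal.toENat_eq_top, ← Cardinal.infinite_iff] at hi
  obtain ⟨j, hj⟩ := Infinite.exists_notMem_finset (X.biUnion fun x => (p x).support)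
  refine ⟨Finsupp.lapply j ∘ₗ p, fun x hx => ?_, fun h0 => ?_⟩
  · by_contra h
    exact hj (Finset.mem_biUnion.mpr ⟨x, hx, Finsupp.mem_support_iff.mpr h⟩)
  · have := hV.simple i
    have := IsSimpleModule.nontrivial T (V i)
    obtain ⟨v, hv⟩ := exists_ne (0 : V i)
    obtain ⟨x, hx⟩ := hp (Finsupp.single j v)
    have := LinearMap.congr_fun h0 x
    rw [LinearMap.comp_apply, hx] at this
    exact hv (by simpa using this)

theorem IsSimpleSystem.dimVec_eq_zero (hV : IsSimpleSystem V) {i : Fin s}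
    (h : ∀ f : Q →ₗ[T] V i, f = 0) : dimVec V Q i = 0 := by
  obtain ⟨κ, ⟨e⟩⟩ := hV.exists_coordinates Q
  rw [hV.dimVec_eq κ e]
  have : IsEmpty (κ i) := ⟨fun j => by
    have := hV.simple i
    have := IsSimpleModule.nontrivial T (V i)
    obtain ⟨v, hv⟩ := exists_ne (0 : V i)
    obtain ⟨x, hx⟩ := ((LinearMap.proj_surjective (R := T) (φ := fun i => κ i →₀ V i) i).comp
      (e.surjective.comp (Submodule.mkQ_surjective _))) (Finsupp.single j v)
    have h0 := LinearMap.congr_fun (h (Finsupp.lapply j ∘ₗ LinearMap.proj i ∘ₗ e.toLinearMap ∘ₗ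
      Submodule.mkQ _)) x
    apply hv
    have hx' : (e (Submodule.Quotient.mk x)) i = Finsupp.single j v := hx
    simpa [hx'] using h0⟩
  simp

end Semisimple

/-! ### Additivity of the dimension vector -/

section DimVec

variable {T : Type w} [Ring T] {s : ℕ} {V : Fin s → ModuleCat.{w} T}
  {P Q : Type w} [AddCommGroup P] [Module T P] [AddCommGroup Q] [Module T Q]

/-- The quotient by `I N` commutes with finite direct sums. -/
def quotientProdEquiv (I : Ideal T) : ((P × Q) ⧸ (I • ⊤ : Submodule T (P × Q))) ≃ₗ[T]
    (P ⧸ (I • ⊤ : Submodule T P)) × (Q ⧸ (I • ⊤ : Submodule T Q)) :=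
  LinearEquiv.ofLinearMap
    (LinearMap.prod
      (Submodule.mapQ _ _ (LinearMap.fst T P Q) fun _ hx => map_mem_smul_top I _ hx)
      (Submodule.mapQ _ _ (LinearMap.snd T P Q) fun _ hx => map_mem_smul_top I _ hx))
    (LinearMap.coprod
      (Submodule.mapQ _ _ (LinearMap.inl T P Q) fun _ hx => map_mem_smul_top I _ hx)
      (Submodule.mapQ _ _ (LinearMap.inr T P Q) fun _ hx => map_mem_smul_top I _ hx))
    (by
      refine LinearMap.prod_ext (Submodule.linearMap_qext _ ?_) (Submodule.linearMap_qext _ ?_) <;>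
      ext <;> simp)
    (by
      refine Submodule.linearMap_qext _ (LinearMap.ext fun x => ?_)
      obtain ⟨x, y⟩ := x
      simp [← Submodule.Quotient.mk_add])

theorem IsSimpleSystem.dimVec_prod (hV : IsSimpleSystem V) :
    dimVec V (P × Q) = dimVec V P + dimVec V Q := by
  funext i
  have := hV.strongRankCondition i
  have := hV.free i
  let A := P ⧸ (Ring.jacobson T • ⊤ : Submodule T P)
  let B := Q ⧸ (Ring.jacobson T • ⊤ : Submodule T Q)
  let e : (V i →ₗ[T] A × B) ≃ₗ[EndOp T (V i)] (V i →ₗ[T] A) × (V i →ₗ[T] B) :=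
    { toFun := fun f => (LinearMap.fst T A B ∘ₗ f, LinearMap.snd T A B ∘ₗ f)
      invFun := fun f => f.1.prod f.2
      map_add' := fun _ _ => rfl
      map_smul' := fun _ _ => rfl
      left_inv := fun _ => rfl
      right_inv := fun _ => rfl }
  rw [Pi.add_apply]
  unfold dimVec
  rw [((homCongr (M := V i) (quotientProdEquiv (P := P) (Q := Q) (Ring.jacobson T))).trans e).rank_eq,
    rank_prod', map_add]

theorem IsSimpleSystem.dimVec_of_subsingleton (hV : IsSimpleSystem V) [Subsingleton P] :
    dimVec V P = 0 := by
  funext i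
  have := hV.strongRankCondition i
  have := hV.simple i
  have := IsSimpleModule.nontrivial T (V i)
  have : Subsingleton (V i →ₗ[T] P ⧸ (Ring.jacobson T • ⊤ : Submodule T P)) :=
    ⟨fun f g => LinearMap.ext fun x => Subsingleton.elim _ _⟩
  rw [Pi.zero_apply]
  unfold dimVec
  rw [rank_subsingleton', map_zero]

end DimVec

/-! ### Closure properties of countable generation -/

section CountablySpanned

variable {T P : Type*} [Ring T] [AddCommGroup P] [Module T P]

theorem IsCountablySpanned.of_countable {A : Set P} (hA : A.Countable)
    (h : Submodule.span T A = ⊤) : IsCountablySpanned T P := by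
  obtain ⟨p, hp⟩ := (hA.insert 0).exists_eq_range (Set.insert_nonempty _ _)
  refine ⟨p, ?_⟩
  rw [← hp, Submodule.span_insert_zero, h]

theorem IsCountablySpanned.self (T : Type*) [Ring T] : IsCountablySpanned T T :=
  .of_countable (Set.countable_singleton 1) (Ideal.span_singleton_one)

theorem IsCountablySpanned.finsupp (hP : IsCountablySpanned T P) (κ : Type*) [Countable κ] :
    IsCountablySpanned T (κ →₀ P) := by
  obtain ⟨p, hp⟩ := hP
  refine .of_countable (Set.countable_range fun k : κ × ℕ => Finsupp.single k.1 (p k.2)) ?_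
  rw [eq_top_iff, ← Finsupp.iSup_lsingle_range, iSup_le_iff]
  intro k
  rw [LinearMap.range_eq_map, ← hp, Submodule.map_span_le]
  rintro _ ⟨n, rfl⟩
  exact Submodule.subset_span ⟨(k, n), rfl⟩

theorem IsCountablySpanned.prod {Q : Type*} [AddCommGroup Q] [Module T Q]
    (hP : IsCountablySpanned T P) (hQ : IsCountablySpanned T Q) : IsCountablySpanned T (P × Q) := by
  obtain ⟨p, hp⟩ := hP
  obtain ⟨q, hq⟩ := hQ
  refine .of_countable (A := LinearMap.inl T P Q '' Set.range p ∪ LinearMap.inr T P Q '' Set.range q)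
    (((Set.countable_range p).image _).union ((Set.countable_range q).image _)) ?_
  rw [LinearMap.span_inl_union_inr, hp, hq, Submodule.prod_top]

end CountablySpanned

/-! ### Projectivity of certain sequential colimits -/

section Telescope

variable {T F : Type*} [Ring T] [AddCommGroup F] [Module T F]

/-- A module with a locally finite family of endomorphisms summing to the identity, all factoring
through a projective module, is projective. -/
theorem projective_of_locallyFinite [Module.Projective T F] {L : Type*} [AddCommGroup L]
    [Module T L] (a : ℕ → L →ₗ[T] F) (b : ℕ → F →ₗ[T] L)
    (h : ∀ z, ∃ n, (∀ k ≥ n, a k z = 0) ∧ ∑ k ∈ Finset.range n, b k (a k z) = z) :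
    Module.Projective T L := by
  classical
  have hf : ∀ z, (Function.support fun k => a k z).Finite := fun z => by
    obtain ⟨n, hn, -⟩ := h z
    refine (Finset.range n).finite_toSet.subset fun k hk => ?_
    by_contra hkn
    exact hk (hn k (by simpa using hkn))
  let σ : L →ₗ[T] (ℕ →₀ F) :=
    { toFun := fun z => Finsupp.ofSupportFinite (fun k => a k z) (hf z)
      map_add' := fun x y => by ext k; exact map_add (a k) x y
      map_smul' := fun t x => by ext k; exact map_smul (a k) t x }
  have : Module.Projective T (ℕ →₀ F) := .of_equiv (finsuppLequivDFinsupp T).symm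
  refine Module.Projective.of_split σ (Finsupp.lsum ℕ b) (LinearMap.ext fun z => ?_)
  obtain ⟨n, hn, hz⟩ := h z
  rw [LinearMap.comp_apply, Finsupp.lsum_apply, LinearMap.id_apply]
  conv_rhs => rw [← hz]
  refine Finsupp.sum_of_support_subset _ (fun k hk => ?_) _ (fun k _ => map_zero _)
  rw [Finset.mem_range]
  by_contra hkn
  exact Finsupp.mem_support_iff.mp hk (hn k (by simpa using hkn))

/-- The relations defining the telescope of an endomorphism. -/
noncomputable def telescopeRel (φ : F →ₗ[T] F) : Submodule T (ℕ →₀ F) :=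
  LinearMap.range (Finsupp.lsum ℕ fun n =>
    (Finsupp.lsingle n : F →ₗ[T] (ℕ →₀ F)) - Finsupp.lsingle (n + 1) ∘ₗ φ)

/-- The colimit of the sequence `F → F → F → ⋯` with all maps equal to `φ`. -/
abbrev Telescope (φ : F →ₗ[T] F) : Type _ := (ℕ →₀ F) ⧸ telescopeRel φ

/-- The `n`-th structure map of the telescope. -/
noncomputable def telescopeOf (φ : F →ₗ[T] F) (n : ℕ) : F →ₗ[T] Telescope φ :=
  (telescopeRel φ).mkQ ∘ₗ Finsupp.lsingle n

theorem telescopeOf_succ (φ : F →ₗ[T] F) (n : ℕ) (x : F) :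
    telescopeOf φ (n + 1) (φ x) = telescopeOf φ n x := by
  symm
  rw [← sub_eq_zero, telescopeOf, telescopeOf, LinearMap.comp_apply, LinearMap.comp_apply,
    ← map_sub, Submodule.mkQ_apply, Submodule.Quotient.mk_eq_zero]
  exact ⟨Finsupp.single n x, by simp⟩

theorem telescopeOf_add (φ : F →ₗ[T] F) (n d : ℕ) (x : F) :
    telescopeOf φ (n + d) ((φ ^ d) x) = telescopeOf φ n x := by
  induction d with
  | zero => rfl
  | succ d ih => rw [pow_succ', Module.End.mul_apply, ← add_assoc, telescopeOf_succ, ih]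

theorem exists_telescopeOf (φ : F →ₗ[T] F) (z : Telescope φ) :
    ∃ n, ∀ m ≥ n, ∃ x, telescopeOf φ m x = z := by
  obtain ⟨c, rfl⟩ := Submodule.Quotient.mk_surjective _ z
  induction c using Finsupp.induction_linear with
  | zero => exact ⟨0, fun m _ => ⟨0, map_zero _⟩⟩
  | add c d hc hd =>
    obtain ⟨n, hn⟩ := hc
    obtain ⟨k, hk⟩ := hd
    refine ⟨max n k, fun m hm => ?_⟩
    obtain ⟨x, hx⟩ := hn m (le_trans (le_max_left _ _) hm)
    obtain ⟨y, hy⟩ := hk m (le_trans (le_max_right _ _) hm)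
    exact ⟨x + y, by rw [map_add, hx, hy, Submodule.Quotient.mk_add]⟩
  | single n x =>
    refine ⟨n, fun m hm => ⟨(φ ^ (m - n)) x, ?_⟩⟩
    obtain ⟨d, rfl⟩ := Nat.exists_eq_add_of_le hm
    rw [Nat.add_sub_cancel_left, telescopeOf_add]
    rfl

/-- The compatibility with the transition maps that lets the maps `θ^n φ^(k+1)` on the terms descend
to the telescope. -/
theorem telescope_aux (φ θ : F →ₗ[T] F) (h : ∀ x, θ (φ (φ x)) = φ x)
    (n k : ℕ) (x : F) :
    (θ ^ (n + 1)) ((φ ^ (k + 1)) (φ x)) = (θ ^ n) ((φ ^ (k + 1)) x) := by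
  have h1 : (φ ^ (k + 1)) (φ x) = φ (φ ((φ ^ k) x)) := by
    rw [← Module.End.mul_apply, ← pow_succ, pow_succ', pow_succ']
    rfl
  rw [h1, pow_succ θ, Module.End.mul_apply, h, pow_succ' φ, Module.End.mul_apply]

/-- If `θ φ φ = φ`, the map from the telescope to its `(k+1)`-st term that restricts to `φ` on
the `k`-th term. -/
noncomputable def telescopeRetract (φ θ : F →ₗ[T] F) (h : ∀ x, θ (φ (φ x)) = φ x)
    (k : ℕ) : Telescope φ →ₗ[T] F :=
  (telescopeRel φ).liftQ (Finsupp.lsum ℕ fun n => (θ ^ n) ∘ₗ (φ ^ (k + 1))) <| by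
    rintro _ ⟨c, rfl⟩
    induction c using Finsupp.induction_linear with
    | zero => simp
    | add c d hc hd => rw [map_add]; exact add_mem hc hd
    | single n x =>
      rw [Finsupp.lsum_single, LinearMap.mem_ker, LinearMap.sub_apply, map_sub,
        LinearMap.comp_apply, Finsupp.lsingle_apply, Finsupp.lsingle_apply, Finsupp.lsum_single,
        Finsupp.lsum_single, LinearMap.comp_apply, LinearMap.comp_apply, telescope_aux φ θ h,
        sub_self]

theorem telescopeRetract_telescopeOf (φ θ : F →ₗ[T] F) (h : ∀ x, θ (φ (φ x)) = φ x)
    (k n : ℕ) (x : F) :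
    telescopeRetract φ θ h k (telescopeOf φ n x) = (θ ^ n) ((φ ^ (k + 1)) x) := by
  simp [telescopeRetract, telescopeOf]

theorem telescopeRetract_telescopeOf_self (φ θ : F →ₗ[T] F) (h : ∀ x, θ (φ (φ x)) = φ x)
    (k : ℕ) (x : F) :
    telescopeRetract φ θ h k (telescopeOf φ k x) = φ x := by
  rw [telescopeRetract_telescopeOf]
  induction k with
  | zero => simp
  | succ k ih =>
    rw [← ih, ← telescope_aux φ θ h k k x, ← Module.End.mul_apply (φ ^ (k + 1)), ← pow_succ]

theorem telescopeOf_telescopeRetract (φ θ : F →ₗ[T] F) (h : ∀ x, θ (φ (φ x)) = φ x)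
    {n m : ℕ} (hnm : n ≤ m) (x : F) :
    telescopeOf φ (m + 1) (telescopeRetract φ θ h m (telescopeOf φ n x)) = telescopeOf φ n x := by
  obtain ⟨d, rfl⟩ := Nat.exists_eq_add_of_le hnm
  rw [← telescopeOf_add φ n d x, telescopeRetract_telescopeOf_self, telescopeOf_succ]

theorem telescope_projective [Module.Projective T F] (φ θ : F →ₗ[T] F) (h : ∀ x, θ (φ (φ x)) = φ x) :
    Module.Projective T (Telescope φ) := by
  -- `g m` factors through `F` and fixes the image of every term up to the `m`-th, so the sequence
  -- `g` is pointwise eventually the identity.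
  let g : ℕ → Telescope φ →ₗ[T] Telescope φ :=
    fun m => telescopeOf φ (m + 1) ∘ₗ telescopeRetract φ θ h m
  have hg : ∀ {n m : ℕ}, n ≤ m → ∀ x, g m (telescopeOf φ n x) = telescopeOf φ n x :=
    fun hnm x => telescopeOf_telescopeRetract φ θ h hnm x
  have hgg : ∀ {n m : ℕ}, n + 1 ≤ m → ∀ z, g m (g n z) = g n z := fun hnm z => hg hnm _
  -- The successive differences form a locally finite family with sum the identity.
  let e : ℕ → Telescope φ →ₗ[T] Telescope φ := fun k => Nat.casesOn k (g 0) fun k => g (k + 1) - g k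
  have hge : ∀ k z, g (k + 1) (e k z) = e k z := by
    rintro (_ | k) z
    · exact hgg le_rfl z
    · change g (k + 2) (g (k + 1) z - g k z) = g (k + 1) z - g k z
      rw [map_sub, hgg (by omega), hgg (by omega)]
  -- The values of `e k` lie in the image of term `k + 1`, so `g (k + 1)` fixes them; it passes
  -- through term `k + 2`, whence the shifts.
  refine projective_of_locallyFinite (fun k => telescopeRetract φ θ h (k + 1) ∘ₗ e k)
    (fun k => telescopeOf φ (k + 2)) fun z => ?_
  obtain ⟨n, hn⟩ := exists_telescopeOf φ z
  obtain ⟨x, rfl⟩ := hn n le_rfl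
  refine ⟨n + 1, fun k hk => ?_, ?_⟩
  · obtain ⟨d, rfl⟩ := Nat.exists_eq_add_of_le hk
    have : n + 1 + d = n + d + 1 := by omega
    rw [this]
    change telescopeRetract φ θ h _ (g (n + d + 1) _ - g (n + d) _) = 0
    rw [hg (by omega), hg (by omega), sub_self, map_zero]
  · have h1 : ∀ k, telescopeOf φ (k + 2) ((telescopeRetract φ θ h (k + 1) ∘ₗ e k)
        (telescopeOf φ n x)) = e k (telescopeOf φ n x) := fun k => hge k _
    have h2 : ∀ k z, ∑ i ∈ Finset.range (k + 1), e i z = g k z := by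
      intro k z
      induction k with
      | zero => simp [e]
      | succ k ih =>
        rw [Finset.sum_range_succ, ih]
        change g k z + (g (k + 1) z - g k z) = g (k + 1) z
        abel
    rw [Finset.sum_congr rfl fun k _ => h1 k, h2, hg le_rfl]

end Telescope

/-! ### A projective module attached to an idempotent ideal -/

section IdempotentIdeal

variable {T : Type w} [Ring T]

/-- An idempotent ideal that is finitely generated as a right ideal is the trace ideal of a
countably generated projective module `L` with `I L = L`. -/
theorem exists_projective_of_idempotent (I : Ideal T) [I.IsTwoSided] (hI : I ≤ I • I) {m : ℕ}
    (x : Fin m → T) (hx : ∀ j, x j ∈ I) (hxI : ∀ y ∈ I, ∃ t : Fin m → T, y = ∑ j, x j * t j) :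
    ∃ (L : ModuleCat.{w} T), Module.Projective T L ∧ IsCountablySpanned T L ∧
      (I • ⊤ : Submodule T L) = ⊤ ∧ ∃ l : L, ∀ y ∈ I, ∃ f : L →ₗ[T] T, f l = y := by
  have hxx : ∀ y ∈ I, ∃ c : Fin m → Fin m → T, y = ∑ j, ∑ k, x j * x k * c j k := by
    intro y hy
    refine Submodule.smul_induction_on (hI hy) ?_ ?_
    · intro a ha b hb
      obtain ⟨t, ht⟩ := hxI a ha
      choose u hu using fun j => hxI (t j * b) (I.mul_mem_left _ hb)
      refine ⟨u, ?_⟩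
      rw [smul_eq_mul, ht, Finset.sum_mul]
      refine Finset.sum_congr rfl fun j _ => ?_
      rw [mul_assoc, hu, Finset.mul_sum]
      exact Finset.sum_congr rfl fun k _ => (mul_assoc _ _ _).symm
    · rintro a b ⟨c, rfl⟩ ⟨d, rfl⟩
      refine ⟨c + d, ?_⟩
      simp only [Pi.add_apply, mul_add, Finset.sum_add_distrib]
  choose c hc using fun i => hxx (x i) (hx i)
  -- The free module on words contains at once all stages of `T → T^m → T^(m²) → ⋯`, each map being
  -- given by the row of the generators `x j`.
  let F := List (Fin m) →₀ T
  let φ : F →ₗ[T] F :=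
    Finsupp.linearCombination T fun v => ∑ j, x j • Finsupp.single (j :: v) (1 : T)
  -- The coefficients expressing `x i` through products `x j * x k` give `θ φ φ = φ`. The value on
  -- words of length below two is immaterial, as `φ φ` produces only longer words.
  let θ : F →ₗ[T] F := Finsupp.linearCombination T fun v => match v with
    | k :: j :: v => ∑ i, c i j k • Finsupp.single (i :: v) (1 : T)
    | _ => 0
  have hφ : ∀ v, φ (Finsupp.single v 1) = ∑ j, x j • Finsupp.single (j :: v) (1 : T) := by
    intro v
    exact (Finsupp.linearCombination_single _ _ _).trans (one_smul _ _)
  have hθ : ∀ k j v, θ (Finsupp.single (k :: j :: v) 1) =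
      ∑ i, c i j k • Finsupp.single (i :: v) (1 : T) := by
    intro k j v
    exact (Finsupp.linearCombination_single _ _ _).trans (one_smul _ _)
  have h : ∀ y, θ (φ (φ y)) = φ y := by
    suffices θ ∘ₗ φ ∘ₗ φ = φ from fun y => LinearMap.congr_fun this y
    refine Finsupp.lhom_ext' fun v => LinearMap.ext_ring ?_
    change θ (φ (φ (Finsupp.single v 1))) = φ (Finsupp.single v 1)
    simp only [hφ, map_sum, map_smul, hθ, Finset.smul_sum, smul_smul]
    conv_rhs => enter [2, i]; rw [hc i]; simp only [Finset.sum_smul]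
    conv_rhs => rw [Finset.sum_comm]
    exact Finset.sum_congr rfl fun _ _ => Finset.sum_comm
  have hφI : ∀ y, φ y ∈ (I • ⊤ : Submodule T F) := by
    intro y
    induction y using Finsupp.induction_linear with
    | zero => simp
    | add y z hy hz => rw [map_add]; exact add_mem hy hz
    | single v t =>
      rw [← mul_one t, ← smul_eq_mul, ← Finsupp.smul_single, map_smul, hφ]
      exact Submodule.smul_mem _ _
        (sum_mem fun j _ => Submodule.smul_mem_smul (hx j) trivial)
  refine ⟨ModuleCat.of T (Telescope φ), telescope_projective φ θ h, ?_, ?_,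
    telescopeOf φ 0 (Finsupp.single [] 1), fun y hy => ?_⟩
  · exact (((IsCountablySpanned.self T).finsupp (List (Fin m))).finsupp ℕ).of_surjective
      (telescopeRel φ).mkQ (Submodule.mkQ_surjective _)
  · rw [eq_top_iff]
    intro z _
    obtain ⟨n, hn⟩ := exists_telescopeOf φ z
    obtain ⟨y, rfl⟩ := hn n le_rfl
    rw [← telescopeOf_succ]
    exact map_mem_smul_top I (telescopeOf φ (n + 1)) (hφI y)
  · obtain ⟨t, rfl⟩ := hxI y hy
    -- The retraction sends `l` to `φ` of the empty word, which is `∑ x j [j]`; sending each `[j]`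
    -- to `t j` then gives `y`.
    refine ⟨(Finsupp.linearCombination T fun v : List (Fin m) => match v with
      | [j] => t j
      | _ => 0) ∘ₗ telescopeRetract φ θ h 0, ?_⟩
    rw [LinearMap.comp_apply, telescopeRetract_telescopeOf_self, hφ]
    simp

end IdempotentIdeal

/-! ### The trace ideal relative to a finite set -/

section RelativeTrace

variable {T : Type w} [Ring T] {Q : Type w} [AddCommGroup Q] [Module T Q]

/-- The ideal of `T` spanned by the values of the maps `Q → T` that vanish on `X`. -/
def relTrace (T : Type w) [Ring T] {Q : Type w} [AddCommGroup Q] [Module T Q] (X : Finset Q) :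
    Ideal T :=
  Submodule.span T {y | ∃ h : Q →ₗ[T] T, (∀ x ∈ X, h x = 0) ∧ ∃ q, h q = y}

theorem apply_mem_relTrace {X : Finset Q} {h : Q →ₗ[T] T} (hX : ∀ x ∈ X, h x = 0) (q : Q) :
    h q ∈ relTrace T X :=
  Submodule.subset_span ⟨h, hX, q, rfl⟩

instance relTrace_isTwoSided (X : Finset Q) : (relTrace T X).IsTwoSided where
  mul_mem_of_left {a} b ha := by
    have : relTrace T X ≤ Submodule.comap (LinearMap.toSpanSingleton T T b) (relTrace T X) := by
      refine Submodule.span_le.mpr ?_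
      rintro _ ⟨h, hX, q, rfl⟩
      exact apply_mem_relTrace (h := LinearMap.toSpanSingleton T T b ∘ₗ h)
        (fun x hx => by simp [hX x hx]) q
    exact this ha

/-- Modulo the relative trace ideal, a projective module is finitely generated. -/
theorem exists_finset_relTrace [Module.Projective T Q] (X : Finset Q) :
    ∃ Y : Finset Q, ∀ q : Q, ∃ q' ∈ Submodule.span T (Y : Set Q),
      q - q' ∈ (relTrace T X • ⊤ : Submodule T Q) := by
  classical
  obtain ⟨s, hs⟩ := (Module.projective_def' (R := T) (P := Q)).mp inferInstance
  -- Dual-basis coordinates outside `Y` vanish on `X`, so their values lie in the ideal.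
  let Y : Finset Q := X.biUnion fun x => (s x).support
  have hY : ∀ a ∉ Y, ∀ q, s q a ∈ relTrace T X := fun a ha q =>
    apply_mem_relTrace (h := Finsupp.lapply a ∘ₗ s) (fun x hx => by
      by_contra h0
      exact ha (Finset.mem_biUnion.mpr ⟨x, hx, Finsupp.mem_support_iff.mpr h0⟩)) q
  refine ⟨Y, fun q => ⟨∑ a ∈ (s q).support with a ∈ Y, s q a • a, ?_, ?_⟩⟩
  · refine Submodule.sum_mem _ fun a ha => Submodule.smul_mem _ _ (Submodule.subset_span ?_)
    exact (Finset.mem_filter.mp ha).2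
  · have h1 : q = ∑ a ∈ (s q).support, s q a • a := (LinearMap.congr_fun hs q).symm
    have h2 : q - ∑ a ∈ (s q).support with a ∈ Y, s q a • a =
        ∑ a ∈ (s q).support with a ∉ Y, s q a • a := by
      rw [sub_eq_iff_eq_add, add_comm, Finset.sum_filter_add_sum_filter_not, ← h1]
    rw [h2]
    exact Submodule.sum_mem _ fun a ha =>
      Submodule.smul_mem_smul (hY a (Finset.mem_filter.mp ha).2 q) trivial

theorem finite_quotient_relTrace [Module.Projective T Q] (X : Finset Q) :
    Module.Finite T (Q ⧸ (relTrace T X • ⊤ : Submodule T Q)) := by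
  obtain ⟨Y, hY⟩ := exists_finset_relTrace (T := T) X
  have h := (Submodule.fg_span (R := T) Y.finite_toSet).map
    (Submodule.mkQ (relTrace T X • ⊤ : Submodule T Q))
  refine ⟨?_⟩
  convert h
  symm
  rw [eq_top_iff]
  intro z _
  obtain ⟨q, rfl⟩ := Submodule.Quotient.mk_surjective _ z
  obtain ⟨q', hq', h⟩ := hY q
  exact ⟨q', hq', ((Submodule.Quotient.eq _).mpr h).symm⟩

variable {s : ℕ} {V : Fin s → ModuleCat.{w} T}

theorem smul_eq_zero_of_mem_relTrace {X : Finset Q} {N : Type*} [AddCommGroup N] [Module T N]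
    (hX : ∀ f : Q →ₗ[T] N, (∀ x ∈ X, f x = 0) → f = 0) {y : T} (hy : y ∈ relTrace T X) (v : N) :
    y • v = 0 := by
  have : relTrace T X ≤ LinearMap.ker (LinearMap.toSpanSingleton T N v) := by
    refine Submodule.span_le.mpr ?_
    rintro _ ⟨h, hh, q, rfl⟩
    exact LinearMap.congr_fun
      (hX (LinearMap.toSpanSingleton T N v ∘ₗ h) fun x hx => by simp [hh x hx]) q
  exact this hy

variable [IsSemisimpleModule T (T ⧸ Ring.jacobson T)]

/-- If the ideal killed `V i`, a map `Q → V i` would be determined by its values on a finite set,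
contrary to infinite multiplicity. -/
theorem IsSimpleSystem.exists_smul_ne_zero (hV : IsSimpleSystem V) [Module.Projective T Q]
    (X : Finset Q) {i : Fin s} (hi : dimVec V Q i = ⊤) :
    ∃ y ∈ relTrace T X, ∃ v : V i, y • v ≠ 0 := by
  by_contra! H
  obtain ⟨Y, hY⟩ := exists_finset_relTrace (T := T) X
  obtain ⟨f, hf, hf0⟩ := hV.exists_map_of_dimVec_eq_top hi Y
  apply hf0
  ext q
  obtain ⟨q', hq', h⟩ := hY q
  have h1 : f q' = 0 := by
    have : Submodule.span T (Y : Set Q) ≤ LinearMap.ker f := Submodule.span_le.mpr hf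
    exact this hq'
  have h2 : (relTrace T X • ⊤ : Submodule T Q) ≤ LinearMap.ker f :=
    Submodule.smul_le.mpr fun r hr x _ => by rw [LinearMap.mem_ker, map_smul, H r hr]
  have h3 : f (q - q') = 0 := h2 h
  rw [map_sub, h1, sub_zero] at h3
  exact h3

/-- The relative trace ideal is idempotent when `X` detects the finite multiplicities. -/
theorem IsSimpleSystem.relTrace_le_smul_self (hV : IsSimpleSystem V) [IsNoetherianRing T]
    [Module.Projective T Q] (X : Finset Q)
    (hX : ∀ i, dimVec V Q i ≠ ⊤ → ∀ f : Q →ₗ[T] V i, (∀ x ∈ X, f x = 0) → f = 0) :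
    relTrace T X ≤ relTrace T X • relTrace T X := by
  set I := relTrace T X with hI
  let K : Submodule T I := Submodule.comap I.subtype (I • I)
  by_contra hne
  have hK : K ≠ ⊤ := fun h => hne fun y hy => by
    have : (⟨y, hy⟩ : I) ∈ K := h ▸ trivial
    exact this
  -- If `I² ≠ I`, then `I` has a simple quotient `V i` killed by `I`.
  obtain ⟨m, hm, hKm⟩ := (eq_top_or_exists_le_coatom K).resolve_left hK
  have hs : IsSimpleModule T (I ⧸ m) := isSimpleModule_iff_isCoatom.mpr hm
  obtain ⟨i, ⟨e⟩⟩ := hV.complete (ModuleCat.of T (I ⧸ m)) hs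
  have e' : (I ⧸ m) ≃ₗ[T] V i := e
  let f : I →ₗ[T] V i := e'.toLinearMap ∘ₗ m.mkQ
  have hf : Function.Surjective f := e'.surjective.comp m.mkQ_surjective
  -- Infinite multiplicity is impossible because `I` does not kill such a `V i`. For finite
  -- multiplicity, each composite `Q → I → V i` with first map vanishing on `X` is zero by `hX`; the
  -- images of these maps `Q → I` span `I`, so `I → V i` would be zero.
  by_cases hi : dimVec V Q i = ⊤
  · obtain ⟨y, hy, v, hyv⟩ := hV.exists_smul_ne_zero X hi
    obtain ⟨z, rfl⟩ := hf v
    apply hyv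
    have : y • z ∈ m := hKm (Submodule.smul_mem_smul hy z.2)
    rw [← map_smul]
    change e' (m.mkQ _) = 0
    rw [Submodule.mkQ_apply, (Submodule.Quotient.mk_eq_zero _).mpr this, map_zero]
  · have h0 : I ≤ (LinearMap.ker f).map I.subtype := by
      refine Submodule.span_le.mpr ?_
      rintro _ ⟨h, hh, q, rfl⟩
      let h' : Q →ₗ[T] I := h.codRestrict I fun q => apply_mem_relTrace hh q
      have := hX i hi (f ∘ₗ h') fun x hx => by
        have : h' x = 0 := Subtype.ext (hh x hx)
        rw [LinearMap.comp_apply, this, map_zero]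
      exact ⟨h' q, LinearMap.congr_fun this q, rfl⟩
    have := hV.simple i
    have := IsSimpleModule.nontrivial T (V i)
    obtain ⟨v, hv⟩ := exists_ne (0 : V i)
    obtain ⟨z, rfl⟩ := hf v
    obtain ⟨z', hz', hzz⟩ := h0 z.2
    obtain rfl : z' = z := Subtype.ext hzz
    exact hv hz'

end RelativeTrace

/-! ### Splitting from an inequality of dimension vectors -/

section Summand

variable {T : Type w} [Ring T] {P Q : Type w} [AddCommGroup P] [Module T P]
  [AddCommGroup Q] [Module T Q]

/-- If `Q / I Q` is finitely generated, a lift of a split monomorphism modulo the radical can be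
corrected to a split monomorphism modulo `I`. -/
theorem exists_congrMod_of_finite [IsNoetherianRing T] [Module.Projective T P] (I : Ideal T)
    [Module.Finite T (Q ⧸ (I • ⊤ : Submodule T Q))] (f : P →ₗ[T] Q) (g : Q →ₗ[T] P)
    (h : CongrMod (Ring.jacobson T) (g ∘ₗ f) LinearMap.id) :
    ∃ g' : Q →ₗ[T] P, CongrMod I (g' ∘ₗ f) LinearMap.id := by
  let f' : (P ⧸ (I • ⊤ : Submodule T P)) →ₗ[T] (Q ⧸ (I • ⊤ : Submodule T Q)) :=
    Submodule.mapQ _ _ f fun _ hx => map_mem_smul_top I f hx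
  let k : (P ⧸ (I • ⊤ : Submodule T P)) →ₗ[T] (P ⧸ (I • ⊤ : Submodule T P)) :=
    Submodule.mapQ _ _ (g ∘ₗ f) fun _ hx => map_mem_smul_top I _ hx
  have hf' : Function.Injective f' := by
    rw [injective_iff_map_eq_zero]
    intro z hz
    obtain ⟨x, rfl⟩ := Submodule.Quotient.mk_surjective _ z
    have hz' : f x ∈ (I • ⊤ : Submodule T Q) := (Submodule.Quotient.mk_eq_zero _).mp hz
    obtain ⟨g', -, hg'⟩ := exists_retraction_on_finset f g h {x}
    rw [Submodule.Quotient.mk_eq_zero, ← hg' x (by simp)]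
    exact map_mem_smul_top I g' hz'
  have hk : Function.Injective k := by
    rw [injective_iff_map_eq_zero]
    intro z hz
    obtain ⟨x, rfl⟩ := Submodule.Quotient.mk_surjective _ z
    have hz' : g (f x) ∈ (I • ⊤ : Submodule T P) := (Submodule.Quotient.mk_eq_zero _).mp hz
    obtain ⟨v, -, hv⟩ := exists_leftInverse_on_finset _ h {x}
    rw [Submodule.Quotient.mk_eq_zero, ← hv x (by simp)]
    exact map_mem_smul_top I v hz'
  -- `P/IP` embeds in the noetherian module `Q/IQ`, so the cokernel of `k` is finitely generated;
  -- being `J` times itself, it vanishes by Nakayama's lemma.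
  have : IsNoetherian T (P ⧸ (I • ⊤ : Submodule T P)) := isNoetherian_of_injective f' hf'
  have hks : Function.Surjective k := by
    rw [← LinearMap.range_eq_top]
    by_contra hne
    have h0 : (⊤ : Submodule T ((P ⧸ (I • ⊤ : Submodule T P)) ⧸ LinearMap.range k)) = ⊥ := by
      refine Submodule.FG.eq_bot_of_le_jacobson_smul Module.Finite.fg_top ?_
      intro z _
      obtain ⟨z, rfl⟩ := Submodule.Quotient.mk_surjective _ z
      obtain ⟨x, rfl⟩ := Submodule.Quotient.mk_surjective _ z
      have := map_mem_smul_top (Ring.jacobson T)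
        ((LinearMap.range k).mkQ ∘ₗ (I • ⊤ : Submodule T P).mkQ) (h x)
      rw [map_sub] at this
      have h1 : ((LinearMap.range k).mkQ ∘ₗ (I • ⊤ : Submodule T P).mkQ) ((g ∘ₗ f) x) = 0 :=
        (Submodule.Quotient.mk_eq_zero _).mpr ⟨Submodule.Quotient.mk x, rfl⟩
      rw [h1, zero_sub] at this
      exact (Submodule.neg_mem_iff _).mp this
    apply hne
    rw [eq_top_iff]
    intro z _
    rw [← Submodule.Quotient.mk_eq_zero, ← Submodule.mem_bot T, ← h0]
    trivial
  let e := LinearEquiv.ofBijective k ⟨hk, hks⟩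
  obtain ⟨u, hu⟩ := exists_lift_of_quotient I e.symm.toLinearMap
  refine ⟨u ∘ₗ g, fun x => ?_⟩
  rw [← Submodule.Quotient.mk_eq_zero, Submodule.Quotient.mk_sub, sub_eq_zero]
  refine (hu (g (f x))).trans ?_
  exact e.symm_apply_apply (Submodule.Quotient.mk x)

/-- If every element of `I` is a value of a map from `L`, then every map from a countably
generated projective module into `I P` factors through a countable power of `L`. -/
theorem exists_factorization [Module.Projective T P] (hP : IsCountablySpanned T P) (I : Ideal T)
    {L : Type w} [AddCommGroup L] [Module T L]
    (l : L) (hl : ∀ y ∈ I, ∃ f : L →ₗ[T] T, f l = y) (d : P →ₗ[T] P)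
    (hd : ∀ x, d x ∈ (I • ⊤ : Submodule T P)) :
    ∃ (C : Type w) (_ : Countable C) (a : P →ₗ[T] (C →₀ L)) (b : (C →₀ L) →ₗ[T] P),
      b ∘ₗ a = d := by
  classical
  obtain ⟨p, hp⟩ := hP
  have h1 : (I • ⊤ : Submodule T P) ≤
      LinearMap.range (Finsupp.lsum ℕ fun f : L →ₗ[T] P => f) := by
    refine Submodule.smul_le.mpr fun y hy x _ => ?_
    obtain ⟨f, rfl⟩ := hl y hy
    exact ⟨Finsupp.single (LinearMap.toSpanSingleton T P x ∘ₗ f) l, by simp⟩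
  choose c hc using fun n => h1 (hd (p n))
  -- Countably many maps `L → P` suffice to cover the images of a generating sequence.
  let C : Set (L →ₗ[T] P) := ⋃ n, ((c n).support : Set (L →ₗ[T] P))
  have hC : C.Countable := Set.countable_iUnion fun n => (c n).support.countable_toSet
  let b : (C →₀ L) →ₗ[T] P := Finsupp.lsum ℕ fun f : C => f.1
  have hb : LinearMap.range d ≤ LinearMap.range b := by
    rw [LinearMap.range_eq_map, ← hp, Submodule.map_span_le]
    rintro _ ⟨n, rfl⟩
    rw [← hc, Finsupp.lsum_apply]
    refine Submodule.sum_mem _ fun f hf => ?_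
    exact ⟨Finsupp.single ⟨f, Set.mem_iUnion.mpr ⟨n, hf⟩⟩ (c n f), by simp [b]⟩
  obtain ⟨a, ha⟩ := Module.projective_lifting_property b.rangeRestrict
    (d.codRestrict (LinearMap.range b) fun x => hb ⟨x, rfl⟩) b.surjective_rangeRestrict
  refine ⟨C, hC.to_subtype, a, b, LinearMap.ext fun x => ?_⟩
  exact congrArg Subtype.val (LinearMap.congr_fun ha x)

variable [IsSemisimpleModule T (T ⧸ Ring.jacobson T)] {s : ℕ} {V : Fin s → ModuleCat.{w} T}

/-- Over a noetherian semilocal ring, a countably generated projective module whose dimension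
vector is bounded by that of another one is isomorphic to a direct summand of it. -/
theorem IsSimpleSystem.exists_split [IsNoetherianRing T] (hV : IsSimpleSystem V)
    (hT : ∀ I : Ideal T, I.IsTwoSided → ∃ (m : ℕ) (x : Fin m → T), (∀ j, x j ∈ I) ∧
      ∀ y ∈ I, ∃ t : Fin m → T, y = ∑ j, x j * t j)
    [Module.Projective T P] [Module.Projective T Q]
    (hP : IsCountablySpanned T P) (hQ : IsCountablySpanned T Q) (h : dimVec V P ≤ dimVec V Q) :
    ∃ (f : P →ₗ[T] Q) (g : Q →ₗ[T] P), g ∘ₗ f = LinearMap.id := by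
  classical
  obtain ⟨X, hX⟩ := hV.exists_finset_detecting Q
  obtain ⟨a, b, hab⟩ := hV.exists_split_quotient hP h
  obtain ⟨f, hf⟩ := exists_lift_of_quotient _ a
  obtain ⟨g, hg⟩ := exists_lift_of_quotient _ b
  have hgf : CongrMod (Ring.jacobson T) (g ∘ₗ f) LinearMap.id := fun x => by
    rw [← Submodule.Quotient.mk_eq_zero]
    simp [hf, hg, hab]
  have := finite_quotient_relTrace (T := T) X
  obtain ⟨g', hg'⟩ := exists_congrMod_of_finite (relTrace T X) f g hgf
  obtain ⟨m, x, hx, hxI⟩ := hT (relTrace T X) inferInstance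
  obtain ⟨L, hL, hLc, hLI, l, hl⟩ := exists_projective_of_idempotent (relTrace T X)
    (hV.relTrace_le_smul_self X hX) x hx hxI
  obtain ⟨C, hC, u, v, huv⟩ := exists_factorization hP (relTrace T X) l hl (LinearMap.id - g' ∘ₗ f)
    fun x => hg'.symm x
  have hproj : Module.Projective T (C →₀ L) := .of_equiv (finsuppLequivDFinsupp T).symm
  -- Infinite entries absorb; at a finite entry `I` kills `V i` while `I L = L`, so `L` has no
  -- nonzero map to `V i`.
  have hdim : dimVec V (Q × (C →₀ L)) = dimVec V Q := by
    rw [hV.dimVec_prod]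
    funext i
    by_cases hi : dimVec V Q i = ⊤
    · rw [Pi.add_apply, hi, top_add]
    · rw [Pi.add_apply, hV.dimVec_eq_zero (Q := C →₀ L), add_zero]
      intro k
      refine Finsupp.lhom_ext' fun c => LinearMap.ext fun z => ?_
      have hz : z ∈ (relTrace T X • ⊤ : Submodule T L) := by
        rw [hLI]; trivial
      have hk : (relTrace T X • ⊤ : Submodule T L) ≤ LinearMap.ker (k ∘ₗ Finsupp.lsingle c) :=
        Submodule.smul_le.mpr fun r hr y _ => by
          rw [LinearMap.mem_ker, map_smul]
          exact smul_eq_zero_of_mem_relTrace (hX i hi) hr _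
      exact hk hz
  have hQL : IsCountablySpanned T (Q × (C →₀ L)) := hQ.prod (hLc.finsupp C)
  obtain ⟨e⟩ := hV.nonempty_linearEquiv_quotient hQL hQ hdim
  obtain ⟨ε⟩ := nonempty_linearEquiv_of_quotient hQL hQ e
  -- The splitting is `g' f + v u = g' f + (1 - g' f) = 1`, transported along `Q ⊕ L^(C) ≅ Q`.
  refine ⟨ε.toLinearMap ∘ₗ f.prod u, g'.coprod v ∘ₗ ε.symm.toLinearMap, LinearMap.ext fun x => ?_⟩
  have := LinearMap.congr_fun huv x
  simp only [LinearMap.comp_apply, LinearMap.sub_apply, LinearMap.id_apply] at this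
  simp [this]

end Summand

/-! ### Passing between `Add(M)` and projective modules over `EndOp R M` -/

section Transfer

variable {R : Type u} [Ring R] {M : Type v} [AddCommGroup M] [Module R M]
  {X Y : Type v} [AddCommGroup X] [Module R X] [AddCommGroup Y] [Module R Y]

/-- The functor `Hom_R(M, -)` is faithful on `Add(M)`. -/
theorem InAdd.hom_ext (hX : InAdd R M X) {a b : X →ₗ[R] Y} (h : ∀ f : M →ₗ[R] X, a ∘ₗ f = b ∘ₗ f) :
    a = b := by
  obtain ⟨I, Z, ⟨e⟩⟩ := hX
  let p : (I →₀ M) →ₗ[R] X := LinearMap.fst R X Z ∘ₗ e.symm.toLinearMap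
  have hp : a ∘ₗ p = b ∘ₗ p := Finsupp.lhom_ext' fun i => h (p ∘ₗ Finsupp.lsingle i)
  ext x
  have := LinearMap.congr_fun hp (e (x, 0))
  simpa [p] using this

/-- The functor `Hom_R(M, -)` is full on `Add(M)`, for finitely generated `M`. -/
theorem InAdd.exists_map [Module.Finite R M] (hX : InAdd R M X)
    (φ : (M →ₗ[R] X) →ₗ[EndOp R M] (M →ₗ[R] Y)) : ∃ a : X →ₗ[R] Y, ∀ f, φ f = a ∘ₗ f := by
  obtain ⟨I, Z, ⟨e⟩⟩ := hX
  let p : (I →₀ M) →ₗ[R] X := LinearMap.fst R X Z ∘ₗ e.symm.toLinearMap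
  let i : X →ₗ[R] (I →₀ M) := e.toLinearMap ∘ₗ LinearMap.inl R X Z
  have hpi : ∀ x, p (i x) = x := fun x => by simp [p, i]
  -- By `homFinsuppEquiv`, `φ ∘ postcomp p` is determined on the coordinate inclusions, where
  -- `postcomp k` is made to agree with it.
  let k : (I →₀ M) →ₗ[R] Y := Finsupp.lsum ℕ fun j => φ (p ∘ₗ Finsupp.lsingle j)
  have hk : postcomp k = φ ∘ₗ postcomp p := by
    rw [← LinearMap.cancel_right (homFinsuppEquiv (R := R) (M := M) I).surjective]
    refine Finsupp.lhom_ext' fun j => LinearMap.ext_ring ?_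
    have h1 : homFinsuppEquiv I (Finsupp.single j (1 : EndOp R M)) = Finsupp.lsingle j :=
      (Finsupp.linearCombination_single _ _ _).trans (one_smul _ _)
    change k ∘ₗ homFinsuppEquiv I (Finsupp.single j 1) =
      φ (p ∘ₗ homFinsuppEquiv I (Finsupp.single j 1))
    rw [h1]
    ext m
    simp [k]
  refine ⟨k ∘ₗ i, fun f => ?_⟩
  have h2 : φ (p ∘ₗ i ∘ₗ f) = k ∘ₗ i ∘ₗ f := (LinearMap.congr_fun hk (i ∘ₗ f)).symm
  have h3 : p ∘ₗ i ∘ₗ f = f := LinearMap.ext fun m => hpi (f m)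
  rw [LinearMap.comp_assoc, ← h2, h3]

/-- A countably generated module in `Add(M)` is a direct summand of a countable direct sum of
copies of `M`. -/
theorem InAdd.exists_countable (hX : InAdd R M X) (hc : IsCountablyGenerated R X) :
    ∃ (C : Type v) (_ : Countable C) (i : X →ₗ[R] (C →₀ M)) (p : (C →₀ M) →ₗ[R] X),
      p ∘ₗ i = LinearMap.id := by
  classical
  obtain ⟨I, Z, ⟨e⟩⟩ := hX
  obtain ⟨A, hA, hAX⟩ := hc
  -- The coordinates occurring in the images of a countable generating set.
  let C : Set I := ⋃ a ∈ A, ((e (a, 0)).support : Set I)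
  have hC : C.Countable := hA.biUnion fun a _ => (e (a, 0)).support.countable_toSet
  refine ⟨C, hC.to_subtype, Finsupp.lsubtypeDomain C ∘ₗ e.toLinearMap ∘ₗ LinearMap.inl R X Z,
    LinearMap.fst R X Z ∘ₗ e.symm.toLinearMap ∘ₗ Finsupp.lmapDomain M R Subtype.val, ?_⟩
  apply LinearMap.ext_on hAX
  intro a ha
  have h : Finsupp.mapDomain Subtype.val (Finsupp.subtypeDomain (· ∈ C) (e (a, 0))) = e (a, 0) := by
    ext j
    by_cases hj : j ∈ C
    · exact Finsupp.mapDomain_apply Subtype.val_injective _ (⟨j, hj⟩ : C)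
    · rw [Finsupp.mapDomain_of_notMem_range _ _ (by simpa using hj)]
      symm
      rw [← Finsupp.notMem_support_iff]
      exact fun hs => hj (Set.mem_biUnion ha hs)
  change (e.symm (Finsupp.mapDomain Subtype.val
    (Finsupp.subtypeDomain (· ∈ C) (e (a, 0))))).1 = a
  rw [h, LinearEquiv.symm_apply_apply]

theorem InAdd.hom_projective [Module.Finite R M] (hX : InAdd R M X)
    (hc : IsCountablyGenerated R X) : Module.Projective (EndOp R M) (M →ₗ[R] X) ∧
      IsCountablySpanned (EndOp R M) (M →ₗ[R] X) := by
  obtain ⟨C, hC, i, p, hpi⟩ := hX.exists_countable hc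
  have hpi' : ∀ f : M →ₗ[R] X, postcomp p (postcomp i f) = f := fun f =>
    LinearMap.ext fun m => LinearMap.congr_fun hpi (f m)
  have : Module.Projective (EndOp R M) (M →ₗ[R] (C →₀ M)) := .of_equiv (homFinsuppEquiv C)
  refine ⟨.of_split (postcomp i) (postcomp p) (LinearMap.ext hpi'), ?_⟩
  exact (((IsCountablySpanned.self (EndOp R M)).finsupp C).of_surjective
    (homFinsuppEquiv C).toLinearMap (homFinsuppEquiv C).surjective).of_surjective (postcomp p)
    fun f => ⟨_, hpi' f⟩

theorem InAdd.nonempty_linearEquiv [Module.Finite R M] (hX : InAdd R M X) (hY : InAdd R M Y)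
    (e : (M →ₗ[R] X) ≃ₗ[EndOp R M] (M →ₗ[R] Y)) : Nonempty (X ≃ₗ[R] Y) := by
  obtain ⟨a, ha⟩ := hX.exists_map e.toLinearMap
  obtain ⟨b, hb⟩ := hY.exists_map e.symm.toLinearMap
  refine ⟨LinearEquiv.ofLinearMap a b (hY.hom_ext fun f => ?_) (hX.hom_ext fun f => ?_)⟩
  · rw [LinearMap.comp_assoc, ← hb, ← ha]
    exact e.apply_symm_apply f
  · rw [LinearMap.comp_assoc, ← ha, ← hb]
    exact e.symm_apply_apply f

/-- The kernel of a split epimorphism is a complement. -/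
theorem nonempty_equiv_prod_ker (a : X →ₗ[R] Y) (b : Y →ₗ[R] X) (h : b ∘ₗ a = LinearMap.id) :
    Nonempty (Y ≃ₗ[R] X × LinearMap.ker b) := by
  have hba : ∀ x, b (a x) = x := fun x => LinearMap.congr_fun h x
  have hk : ∀ y, y - a (b y) ∈ LinearMap.ker b := fun y => by simp [hba]
  refine ⟨LinearEquiv.ofLinearMap
    (b.prod ((LinearMap.id - a ∘ₗ b).codRestrict (LinearMap.ker b) hk))
    (a.coprod (LinearMap.ker b).subtype) ?_ ?_⟩
  · ext x
    · simp [hba]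
    · simp [hba]
    · simp
    · simp
  · ext y
    simp

theorem AddCtbl.exists_complement (X Y : AddCtbl R M) (a : X.1 →ₗ[R] Y.1) (b : Y.1 →ₗ[R] X.1)
    (h : b ∘ₗ a = LinearMap.id) :
    ∃ Z : AddCtbl R M, Nonempty (Y.1 ≃ₗ[R] X.1 × Z.1) := by
  obtain ⟨e⟩ := nonempty_equiv_prod_ker a b h
  refine ⟨⟨ModuleCat.of R (LinearMap.ker b), ?_, ?_⟩, ⟨e⟩⟩
  · obtain ⟨A, hA, hAY⟩ := Y.2.1
    let p := LinearMap.snd R X.1 (LinearMap.ker b) ∘ₗ e.toLinearMap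
    have hp : Function.Surjective p := Prod.snd_surjective.comp e.surjective
    refine ⟨p '' A, hA.image _, ?_⟩
    rw [Submodule.span_image, hAY, Submodule.map_top, LinearMap.range_eq_top.mpr hp]
  · obtain ⟨I, W, ⟨k⟩⟩ := Y.2.2
    refine ⟨I, ModuleCat.of R (X.1 × W), ⟨?_⟩⟩
    have e1 : (LinearMap.ker b × X.1 × W) ≃ₗ[R] ((X.1 × LinearMap.ker b) × W) :=
      (LinearEquiv.prodAssoc R (LinearMap.ker b) X.1 W).symm.trans
        (LinearEquiv.prodCongr (LinearEquiv.prodComm R _ _) (LinearEquiv.refl R W))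
    exact (e1.trans (LinearEquiv.prodCongr e.symm (LinearEquiv.refl R W))).trans k

end Transfer

/-! ### Right generators of ideals -/

section NoetherianAlgebra

/-- Scalars from `R` are central, so generators over `R` also serve with coefficients on the right.
-/
theorem exists_right_generators (R : Type*) [CommRing R] [IsNoetherianRing R] {T : Type*} [Ring T]
    [Algebra R T] [Module.Finite R T] (I : Ideal T) :
    ∃ (m : ℕ) (x : Fin m → T), (∀ j, x j ∈ I) ∧ ∀ y ∈ I, ∃ t : Fin m → T, y = ∑ j, x j * t j := by
  obtain ⟨m, x, hx⟩ := Submodule.fg_iff_exists_fin_generating_family.mp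
    (IsNoetherian.noetherian (I.restrictScalars R))
  refine ⟨m, x, fun j => ?_, fun y hy => ?_⟩
  · have : x j ∈ I.restrictScalars R := hx ▸ Submodule.subset_span ⟨j, rfl⟩
    exact this
  · have hy' : y ∈ Submodule.span R (Set.range x) := hx ▸ hy
    obtain ⟨c, rfl⟩ := (Submodule.mem_span_range_iff_exists_fun R).mp hy'
    exact ⟨fun j => algebraMap R T (c j),
      Finset.sum_congr rfl fun j _ => by rw [Algebra.smul_def, Algebra.commutes]⟩

end NoetherianAlgebra

end DirectSummands

/-! ### The main theorem -/

open DirectSummands in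
theorem mainTheorem11 (R : Type u) [CommRing R] [IsNoetherianRing R] [Finite (MaximalSpectrum R)]
    (M : Type v) [AddCommGroup M] [Module R M] [Module.Finite R M] [Nontrivial M] :
    (∃ (s : ℕ) (V : Fin s → ModuleCat.{v} (DirectSummands.EndOp R M)),
      DirectSummands.IsSimpleSystem V) ∧
    ∀ (s : ℕ) (V : Fin s → ModuleCat.{v} (DirectSummands.EndOp R M)), DirectSummands.IsSimpleSystem V →
      ∃ D : DirectSummands.VStar R M →+ (Fin s → ℕ∞),
        (D : DirectSummands.VStar R M → (Fin s → ℕ∞)) = DirectSummands.DMap V ∧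
        Function.Injective D ∧ DirectSummands.IsDivisorHom D := by
  have hfin : Module.Finite R (EndOp R M) := .equiv (MulOpposite.opLinearEquiv R)
  have hss : IsSemisimpleModule (EndOp R M) (EndOp R M ⧸ Ring.jacobson (EndOp R M)) :=
    isSemisimpleModule_quotient_jacobson R (EndOp R M)
  have hnoeth : IsNoetherianRing (EndOp R M) := isNoetherian_of_tower R inferInstance
  refine ⟨exists_isSimpleSystem (EndOp R M), fun s V hV => ?_⟩
  have hprod : ∀ X Y : AddCtbl R M, dimVec V (M →ₗ[R] X.1 × Y.1) =
      dimVec V (M →ₗ[R] X.1) + dimVec V (M →ₗ[R] Y.1) := fun X Y => by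
    rw [← hV.dimVec_prod]
    exact dimVec_congr V
      { toFun := fun f => (LinearMap.fst R X.1 Y.1 ∘ₗ f, LinearMap.snd R X.1 Y.1 ∘ₗ f)
        invFun := fun f => f.1.prod f.2
        map_add' := fun _ _ => rfl
        map_smul' := fun _ _ => rfl
        left_inv := fun _ => rfl
        right_inv := fun _ => rfl }
  let D : VStar R M →+ (Fin s → ℕ∞) :=
    { toFun := DMap V
      map_zero' := by
        have : Subsingleton (M →ₗ[R] PUnit.{v + 1}) := ⟨fun f g => LinearMap.ext fun _ => rfl⟩
        exact hV.dimVec_of_subsingleton (P := M →ₗ[R] PUnit.{v + 1})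
      map_add' := by
        rintro ⟨X⟩ ⟨Y⟩
        exact hprod X Y }
  refine ⟨D, rfl, ?_, ?_⟩
  · rintro ⟨X⟩ ⟨Y⟩ h
    have h' : dimVec V (M →ₗ[R] X.1) = dimVec V (M →ₗ[R] Y.1) := h
    obtain ⟨hXp, hXc⟩ := X.2.2.hom_projective X.2.1
    obtain ⟨hYp, hYc⟩ := Y.2.2.hom_projective Y.2.1
    obtain ⟨e⟩ := hV.nonempty_linearEquiv_quotient hXc hYc h'
    obtain ⟨ε⟩ := nonempty_linearEquiv_of_quotient hXc hYc e
    obtain ⟨k⟩ := X.2.2.nonempty_linearEquiv Y.2.2 ε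
    exact VStar.sound k
  · rintro ⟨X⟩ ⟨Y⟩ ⟨c, h⟩
    have h' : dimVec V (M →ₗ[R] Y.1) = dimVec V (M →ₗ[R] X.1) + c := h
    obtain ⟨hXp, hXc⟩ := X.2.2.hom_projective X.2.1
    obtain ⟨hYp, hYc⟩ := Y.2.2.hom_projective Y.2.1
    -- The vector `c` serves only to give `dim P ≤ dim Q`; the complement comes from the splitting,
    -- as the kernel of the retraction.
    obtain ⟨f, g, hgf⟩ := hV.exists_split (fun I _ => exists_right_generators R I) hXc hYc
      (h' ▸ le_self_add)
    obtain ⟨a, ha⟩ := X.2.2.exists_map f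
    obtain ⟨b, hb⟩ := Y.2.2.exists_map g
    obtain ⟨Z, ⟨e⟩⟩ := AddCtbl.exists_complement X Y a b (X.2.2.hom_ext fun k => by
      rw [LinearMap.comp_assoc, ← ha, ← hb]
      exact LinearMap.congr_fun hgf k)
    exact ⟨VStar.mk Z, VStar.sound (Y := X.sum Z) e⟩
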